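/- Let $q\ge 3$ be an integer. For $K\ge 1$ put $N=Kq$. For permutations $\pi_1,\pi_2$ of the $N$ coordinates, the repeat-accumulate-accumulate (RAA) code of rate $R=1/q$ and block length $N$ is the set of all binary words obtained from $u\in\mathbb F_2^K$ by repeating each bit $q$ times, permuting the $N$ coordinates by $\pi_1$, accumulating, permuting by $\pi_2$, and accumulating again, where accumulation maps $(x_1,\dots,x_N)$ to $(x_1,\,x_1+x_2,\,\dots,\,x_1+\cdots+x_N)$ modulo $2$. The ensemble consists of these codes for all pairs $(\pi_1,\pi_2)$, all pairs being equally likely; $d_{\min}$ denotes the minimum Hamming distance. With $H(x)=-x\ln x-(1-x)\ln(1-x)$ let $$f(\alpha,\beta,\rho)=\frac{H(\alpha)}q-H(\beta)-H(\rho)+(1-\alpha)H\Big(\frac{\beta-\alpha/2}{1-\alpha}\Big)+\alpha\ln2+(1-\beta)H\Big(\frac{\rho-\beta/2}{1-\beta}\Big)+\beta\ln 2,$$ where $(1-\alpha)H(\cdot)$ is read as $0$ for $\alpha=1$. For $0<\rho\le 1/2$ let $$\mathcal G_\rho=\{(\alpha,\beta):\ 0<\alpha\le 2\min(\beta,1-\beta),\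 0<\beta\le 2\min(\rho,1-\rho)\},$$ and consider the system $$(\ast)\quad 0<\alpha\le\tfrac12,\quad \beta=\frac12-\frac{1-\alpha}2\sqrt{1-\Big(\frac{\alpha}{1-\alpha}\Big)^{2/q}},\quad \rho=\frac12-\frac{1-\beta}2\sqrt{1-\Big(\frac{1-\beta}{\beta}\cdot\frac{\beta-\alpha/2}{1-\beta-\alpha/2}\Big)^2}.$$ **Theorem.** (1) Let $0<\rho\le 1/2$. The pairs $(\alpha,\beta)$ that satisfy $(\ast)$ with $\rho$ are exactly the stationary points of $f(\cdot,\cdot,\rho)$ in the interior of $\mathcal G_\rho$. If $f(\cdot,\cdot,\rho)$ attains its maximum over $\mathcal G_\rho$ at $(\alpha,\beta)\in\mathcal G_\rho$, then $(\alpha,\beta)$ satisfies $(\ast)$ with $\rho$. A number $m\ge0$ is the maximum of $f(\cdot,\cdot,\rho)$ over $\mathcal G_\rho$ if and only if it is the maximum of $f(\cdot,\cdot,\rho)$ over the pairs that satisfy $(\ast)$ with $\rho$. (2) There is a number $\hat\rho_{\min}\in(0,1/2)$, depending only on $q$, at which the maximum of $f$ crosses zero: for $0<\rho<\hat\rho_{\min}$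 the function $f(\cdot,\cdot,\rho)$ is negative on $\mathcal G_\rho$; for $\rho=\hat\rho_{\min}$ its maximum over $\mathcal G_\rho$ exists and equals $0$; for $\hat\rho_{\min}<\rho\le 1/2$ its maximum over $\mathcal G_\rho$ exists and is positive. Equivalently, $\hat\rho_{\min}$ is the smallest $\rho$ for which some solution $(\alpha,\beta,\rho)$ of $(\ast)$ satisfies $f(\alpha,\beta,\rho)=0$. (3) The number $\hat\rho_{\min}$ is a lower bound on the asymptotic growth rate coefficient of the minimum distance: for every $\rho<\hat\rho_{\min}$, the fraction of codes in the ensemble of block length $N=Kq$ with $d_{\min}>\rho N$ tends to $1$ as $K\to\infty$. In particular, almost all codes have minimum distance growing linearly with $N$. -/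

import Mathlib

/-- Rate `1/q` repetition encoder: each of the `K` information bits is repeated `q` times. -/
def repetitionEncode (q K : ℕ) (u : Fin K → ZMod 2) : Fin (K * q) → ZMod 2 :=
  fun i => u i.divNat

/-- The accumulator with generator polynomial `1/(1+D)`: the output at time `i` is the
sum modulo two of the inputs up to and including time `i`. -/
def accumulate {N : ℕ} (x : Fin N → ZMod 2) : Fin N → ZMod 2 :=
  fun i => ∑ j ∈ Finset.Iic i, x j

/-- The pairs of interleavers of block length `N = K * q`, which index the ensemble. -/
abbrev Interleavers (q K : ℕ) : Type :=
  Equiv.Perm (Fin (K * q)) × Equiv.Perm (Fin (K * q))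

/-- The repeat-accumulate-accumulate encoder:
repeat, interleave, accumulate, interleave, accumulate. -/
def raaEncode (q K : ℕ) (π : Interleavers q K) (u : Fin K → ZMod 2) :
    Fin (K * q) → ZMod 2 :=
  accumulate (accumulate (repetitionEncode q K u ∘ π.1) ∘ π.2)

/-- The repeat-accumulate-accumulate code with interleavers `π`. -/
def raaCode (q K : ℕ) (π : Interleavers q K) : Set (Fin (K * q) → ZMod 2) :=
  Set.range (raaEncode q K π)

/-- The minimum distance of a code (the least Hamming distance of two distinct codewords). -/
noncomputable def minDistance {N : ℕ} (C : Set (Fin N → ZMod 2)) : ℕ :=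
  sInf {d : ℕ | ∃ x ∈ C, ∃ y ∈ C, x ≠ y ∧ hammingDist x y = d}

/-- The proportion of codes of the ensemble (all pairs of interleavers being equally likely)
whose minimum distance is greater than `ρ * N`, where `N = K * q`. -/
noncomputable def raaFraction (q K : ℕ) (ρ : ℝ) : ℝ :=
  (Nat.card {π : Interleavers q K //
      ρ * ((K * q : ℕ) : ℝ) < (minDistance (raaCode q K π) : ℝ)} : ℝ) /
    (Nat.card (Interleavers q K) : ℝ)

/-- The exponent `f(α, β, ρ)` of the ensemble-average weight enumerator
(`Real.binEntropy` is the binary entropy function with natural logarithms). -/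
noncomputable def raaExponent (q : ℕ) (α β ρ : ℝ) : ℝ :=
  Real.binEntropy α / q - Real.binEntropy β - Real.binEntropy ρ
    + Real.binEntropy ((β - α / 2) / (1 - α)) * (1 - α) + α * Real.log 2
    + Real.binEntropy ((ρ - β / 2) / (1 - β)) * (1 - β) + β * Real.log 2

/-- The region of the pairs `(α, β)` over which `f(α, β, ρ)` is maximized for a fixed `ρ`. -/
def raaRegion (ρ : ℝ) : Set (ℝ × ℝ) :=
  {p | 0 < p.1 ∧ p.1 ≤ 2 * min p.2 (1 - p.2) ∧ 0 < p.2 ∧ p.2 ≤ 2 * min ρ (1 - ρ)}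

/-- The values of `f(α, β, ρ)` over the region, for a fixed `ρ`. -/
def raaValues (q : ℕ) (ρ : ℝ) : Set ℝ :=
  (fun p : ℝ × ℝ => raaExponent q p.1 p.2 ρ) '' raaRegion ρ

/-- The system of equations for the stationary points: `β` as a function of `α`,
and `ρ` as a function of `α` and `β`. For `0 < α ≤ 1/2` all radicands are nonnegative. -/
def RaaSystem (q : ℕ) (α β ρ : ℝ) : Prop :=
  0 < α ∧ α ≤ 1 / 2 ∧
  β = 1 / 2 - (1 - α) / 2 * √(1 - (α / (1 - α)) ^ ((2 : ℝ) / q)) ∧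
  ρ = 1 / 2 - (1 - β) / 2 *
    √(1 - ((1 - β) / β * ((β - α / 2) / (1 - β - α / 2))) ^ 2)

/-- The values of `f(α, β, ρ)` at the solutions of the system, for a fixed `ρ`. -/
def raaSystemValues (q : ℕ) (ρ : ℝ) : Set ℝ :=
  {y | ∃ α β : ℝ, RaaSystem q α β ρ ∧ raaExponent q α β ρ = y}

/-!
The exponent splits as `f(α, β, ρ) = H(α) / q + J(α, β) + J(β, ρ)`, where `J` (`accExponent`) is the
exponent of the accumulator. Written with `Real.negMulLog`, it extends to a continuous function on
`ℝ³` (`extExponent`), and most of the argument concerns this extension.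

*Stationary points.* Both partial derivatives have the form `(log X - log Y) / 2`, and `X = Y` is a
quadratic equation whose root below `1 / 2` is the one in the system (`raaSystem_iff`). On the
part of the boundary that belongs to the region the derivative pointing outwards tends to `-∞`,
so that a maximum lies in the interior (`raaSystem_of_isMaxOn`). On the missing
part, where `α = 0`, the exponent is at most `0`; a positive maximum is therefore attained.

*Threshold.* Gibbs' inequality gives `J(x, y) ≤ (x / 2) log (4 y (1 - y))`. Optimizing over `α`, one
gets `f ≤ (4 β) ^ (q / 2) / q - κ(ρ) β` with `κ(ρ) > 0` for `ρ < 1 / 2`. As `q / 2 > 1`, the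
exponent is negative for small `β`, uniformly in `ρ`. So the set of the `(α, β, ρ)` with nonnegative
exponent is compact for `ρ` bounded away from `1 / 2`, and the threshold is the least `ρ` on it
(`exists_threshold`). Since `f` increases strictly with `ρ`, its maximum is positive above the
threshold.

*Minimum distance.* The probability that the minimum distance is at most `ρ N` is bounded by the
expected number of nonzero words of weight at most `ρ N` (`one_sub_raaFraction_le`). The weight
enumerator of the accumulator is bounded by a product of two binomial coefficients
(`accumulateCount_le`). For an intermediate weight `h > N ^ (1 / 20)` the summands are at most
`poly(N) * exp (N f) ≤ poly(N) * exp (-c h)`, by the linear bound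
`exists_extExponent_le_neg_of_lt_threshold`. The remaining summands are too few and too small to
matter, because a first stage with `q ≥ 3` rarely produces such low weights
(`choose_mul_accumulateProb_le`).
-/

/-! ### The exponent of the accumulator -/

section

open Real Filter Topology

/-- The exponent of one accumulator stage: an interleaved word of relative weight `x` is mapped to a
word of relative weight `y` with probability `exp (N * accExponent x y)`, up to a factor polynomial
in the length `N`. It is written with `Real.negMulLog`, and hence defined and continuous on the
whole plane. -/
noncomputable def accExponent (x y : ℝ) : ℝ :=
  negMulLog (y - x / 2) + negMulLog (1 - y - x / 2) - negMulLog (1 - x) + x * log 2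
    - negMulLog y - negMulLog (1 - y)

/-- The continuous extension of `raaExponent` to all real arguments. It agrees with `raaExponent`
unless `α = 1` or `β = 1`, and on all of `raaRegion ρ`. -/
noncomputable def extExponent (q : ℕ) (α β ρ : ℝ) : ℝ :=
  binEntropy α / q + accExponent α β + accExponent β ρ

theorem accExponent_zero_left (y : ℝ) : accExponent 0 y = 0 := by
  simp [accExponent]

theorem continuous_accExponent : Continuous fun p : ℝ × ℝ => accExponent p.1 p.2 := by
  unfold accExponent
  have := continuous_negMulLog
  fun_prop

theorem continuous_extExponent (q : ℕ) :
    Continuous fun p : ℝ × ℝ × ℝ => extExponent q p.1 p.2.1 p.2.2 := by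
  unfold extExponent
  have h1 : Continuous fun p : ℝ × ℝ × ℝ => accExponent p.1 p.2.1 :=
    continuous_accExponent.comp (by fun_prop : Continuous fun p : ℝ × ℝ × ℝ => (p.1, p.2.1))
  have h2 : Continuous fun p : ℝ × ℝ × ℝ => accExponent p.2.1 p.2.2 :=
    continuous_accExponent.comp (by fun_prop : Continuous fun p : ℝ × ℝ × ℝ => (p.2.1, p.2.2))
  have h3 := binEntropy_continuous
  fun_prop

/-- The terms `s * H(b / s)` of `raaExponent`, without a division. -/
theorem binEntropy_div_mul {b s : ℝ} (hs : s ≠ 0) :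
    binEntropy (b / s) * s = negMulLog b + negMulLog (s - b) - negMulLog s := by
  have h1 : negMulLog b = s * negMulLog (b / s) + b / s * negMulLog s := by
    rw [← negMulLog_mul, div_mul_cancel₀ _ hs]
  have h2 : negMulLog (s - b) = s * negMulLog (1 - b / s) + (1 - b / s) * negMulLog s := by
    rw [← negMulLog_mul, sub_mul, div_mul_cancel₀ _ hs, one_mul]
  rw [h1, h2, binEntropy_eq_negMulLog_add_negMulLog_one_sub]
  ring

theorem raaExponent_eq_ext {q : ℕ} {α β : ℝ} (hα : α ≠ 1) (hβ : β ≠ 1) (ρ : ℝ) :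
    raaExponent q α β ρ = extExponent q α β ρ := by
  unfold raaExponent extExponent accExponent
  rw [binEntropy_div_mul (sub_ne_zero.2 hα.symm), binEntropy_div_mul (sub_ne_zero.2 hβ.symm),
    binEntropy_eq_negMulLog_add_negMulLog_one_sub β,
    binEntropy_eq_negMulLog_add_negMulLog_one_sub ρ]
  rw [show 1 - α - (β - α / 2) = 1 - β - α / 2 by ring,
    show 1 - β - (ρ - β / 2) = 1 - ρ - β / 2 by ring]
  ring

theorem mem_raaRegion {ρ : ℝ} (hρ : ρ ≤ 1 / 2) {α β : ℝ} :
    (α, β) ∈ raaRegion ρ ↔ 0 < α ∧ α ≤ 2 * β ∧ α ≤ 2 * (1 - β) ∧ β ≤ 2 * ρ := by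
  unfold raaRegion
  simp only [Set.mem_ofPred_eq, min_eq_left (show ρ ≤ 1 - ρ by linarith)]
  rw [mul_min_of_nonneg _ _ (by norm_num : (0:ℝ) ≤ 2), le_min_iff]
  constructor
  · rintro ⟨h1, ⟨h2, h3⟩, h4, h5⟩; exact ⟨h1, h2, h3, h5⟩
  · rintro ⟨h1, h2, h3, h5⟩; exact ⟨h1, ⟨h2, h3⟩, by linarith, h5⟩

theorem raaExponent_eq_ext_of_mem {q : ℕ} {α β ρ : ℝ} (hρ : ρ ≤ 1 / 2)
    (h : (α, β) ∈ raaRegion ρ) : raaExponent q α β ρ = extExponent q α β ρ := by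
  obtain ⟨h0, h1, h2, h3⟩ := (mem_raaRegion hρ).1 h
  have hβ : β ≠ 1 := by rintro rfl; linarith
  by_cases hα : α = 1
  -- here `raaExponent` contains a division by zero, multiplied by zero
  · subst hα
    have : β = 1 / 2 := by linarith
    subst this
    unfold raaExponent extExponent accExponent
    rw [binEntropy_div_mul (sub_ne_zero.2 hβ.symm),
      binEntropy_eq_negMulLog_add_negMulLog_one_sub (1/2),
      binEntropy_eq_negMulLog_add_negMulLog_one_sub ρ]
    rw [show 1 - 1 / 2 - (ρ - 1 / 2 / 2) = 1 - ρ - 1 / 2 / 2 by ring]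
    norm_num
    ring
  · exact raaExponent_eq_ext hα hβ ρ

theorem hasDerivAt_accExponent_left {x y : ℝ} (hb : 0 < y - x / 2) (hc : 0 < 1 - y - x / 2) :
    HasDerivAt (fun x => accExponent x y)
      (1 / 2 * log (4 * (y - x / 2) * (1 - y - x / 2) / (1 - x) ^ 2)) x := by
  have hx : 0 < 1 - x := by linarith
  have h1 : HasDerivAt (fun x : ℝ => y - x / 2) (-(1 / 2)) x := by
    simpa using ((hasDerivAt_id x).div_const 2).const_sub y
  have h2 : HasDerivAt (fun x : ℝ => 1 - y - x / 2) (-(1 / 2)) x := by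
    simpa using ((hasDerivAt_id x).div_const 2).const_sub (1 - y)
  have h3 : HasDerivAt (fun x : ℝ => 1 - x) (-1) x := by
    simpa using (hasDerivAt_id x).const_sub 1
  have h4 : HasDerivAt (fun x : ℝ => x * log 2) (log 2) x := by
    simpa using (hasDerivAt_id x).mul_const (log 2)
  have := ((((((hasDerivAt_negMulLog hb.ne').comp x h1).add
    ((hasDerivAt_negMulLog hc.ne').comp x h2)).sub
    ((hasDerivAt_negMulLog hx.ne').comp x h3)).add h4).sub_const (negMulLog y)).sub_const
    (negMulLog (1 - y))
  refine this.congr_deriv ?_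
  rw [log_div (by positivity) (by positivity), log_mul (by positivity) (by positivity),
    log_mul (by positivity) (by positivity), log_pow, show (4:ℝ) = 2 ^ 2 by norm_num, log_pow]
  push_cast
  ring

theorem hasDerivAt_accExponent_right {x y : ℝ} (hx : 0 ≤ x) (hb : 0 < y - x / 2)
    (hc : 0 < 1 - y - x / 2) :
    HasDerivAt (fun y => accExponent x y)
      (log (1 - y - x / 2) - log (y - x / 2) + log y - log (1 - y)) y := by
  have hy : 0 < y := by linarith
  have hy' : 0 < 1 - y := by linarith
  have h1 : HasDerivAt (fun y : ℝ => y - x / 2) 1 y := by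
    simpa using (hasDerivAt_id y).sub_const (x / 2)
  have h2 : HasDerivAt (fun y : ℝ => 1 - y - x / 2) (-1) y := by
    simpa using ((hasDerivAt_id y).const_sub 1).sub_const (x / 2)
  have h3 : HasDerivAt (fun y : ℝ => 1 - y) (-1) y := by
    simpa using (hasDerivAt_id y).const_sub 1
  have := ((((((hasDerivAt_negMulLog hb.ne').comp y h1).add
    ((hasDerivAt_negMulLog hc.ne').comp y h2)).sub_const (negMulLog (1 - x))).add_const
     (x * log 2)).sub (hasDerivAt_negMulLog hy.ne')).sub
    ((hasDerivAt_negMulLog hy'.ne').comp y h3)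
  refine this.congr_deriv ?_
  ring

/-- The inequality `log (t / b) ≤ t / b - 1`, multiplied by `b`, in a form valid for `b = 0`. -/
theorem mul_log_div_le {b t : ℝ} (hb : 0 ≤ b) (ht : 0 < t) : b * log t + negMulLog b ≤ t - b := by
  rcases hb.eq_or_lt with rfl | hb
  · simpa using ht.le
  · have h := log_le_sub_one_of_pos (div_pos ht hb)
    rw [log_div ht.ne' hb.ne'] at h
    have := mul_le_mul_of_nonneg_left h hb.le
    have e : b * (t / b - 1) = t - b := by field_simp
    rw [e] at this
    rw [negMulLog]; linarith

/-- Gibbs' inequality, for the distribution proportional to `(y - x / 2, 1 - y - x / 2)` against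
`(y, 1 - y)`. -/
theorem accExponent_le {x y : ℝ} (h0 : 0 ≤ x) (hb : 0 ≤ y - x / 2) (hc : 0 ≤ 1 - y - x / 2)
    (hy : 0 < y) (hy' : y < 1) : accExponent x y ≤ x / 2 * log (4 * y * (1 - y)) := by
  have hy1 : 0 < 1 - y := by linarith
  have hL : log (4 * y * (1 - y)) = 2 * log 2 + log y + log (1 - y) := by
    rw [log_mul (by positivity) (by positivity), log_mul (by positivity) (by positivity),
      show (4:ℝ) = 2 ^ 2 by norm_num, log_pow]
    push_cast; ring
  rw [hL]
  rcases (show x ≤ 1 by linarith).eq_or_lt with rfl | hx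
  · have : y = 1 / 2 := by linarith
    subst this
    unfold accExponent negMulLog
    norm_num
    ring_nf; rfl
  · have hs : 0 < 1 - x := by linarith
    have h1 := mul_log_div_le hb (mul_pos hs hy)
    have h2 := mul_log_div_le hc (mul_pos hs hy1)
    rw [log_mul hs.ne' hy.ne'] at h1
    rw [log_mul hs.ne' hy1.ne'] at h2
    unfold accExponent
    rw [negMulLog, negMulLog] at *
    simp only [negMulLog] at *
    nlinarith

theorem binEntropy_le {x : ℝ} (hx : x ≤ 1) : binEntropy x ≤ negMulLog x + x := by
  rw [binEntropy_eq_negMulLog_add_negMulLog_one_sub]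
  have := mul_log_div_le (b := 1 - x) (t := 1) (by linarith) one_pos
  simp at this
  linarith

theorem four_mul_mul_lt_one {r : ℝ} (h : r < 1 / 2) : 4 * r * (1 - r) < 1 := by
  nlinarith [mul_pos (sub_pos.2 h) (sub_pos.2 h)]

theorem accExponent_neg {β ρ : ℝ} (hβ : 0 < β) (h2 : β ≤ 2 * ρ) (h3 : ρ < 1 / 2) :
    accExponent β ρ < 0 := by
  have hρ : 0 < ρ := by linarith
  refine (accExponent_le hβ.le (by linarith) (by linarith) (by linarith)
    (by linarith)).trans_lt ?_
  have := log_neg (by nlinarith : 0 < 4 * ρ * (1 - ρ)) (four_mul_mul_lt_one h3)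
  nlinarith

/-- Near the origin the gain `(4 * β) ^ (q / 2) / q`, which the first stage contributes for the best
`α`, is of higher order than the loss in the second stage, which is linear in `β`. This is where
`3 ≤ q` is used. -/
theorem extExponent_le {q : ℕ} (hq : 3 ≤ q) {α β ρ : ℝ} (h0 : 0 ≤ α) (h1 : α ≤ 2 * β)
    (hβ : 0 < β) (hβ' : β ≤ 1 / 4) (h2 : β ≤ 2 * ρ) (h3 : ρ < 1 / 2) :
    extExponent q α β ρ ≤ β * (8 / 3 * √β + 1 / 2 * log (4 * ρ * (1 - ρ))) := by
  have hq' : (3:ℝ) ≤ q := by exact_mod_cast hq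
  have hq0 : (0:ℝ) < q := by linarith
  have hJ1 := accExponent_le h0 (by linarith) (by linarith) hβ (by linarith)
  have hJ2 := accExponent_le hβ.le (by linarith : 0 ≤ ρ - β / 2) (by linarith) (by linarith)
    (by linarith)
  have hH := binEntropy_le (x := α) (by linarith)
  have hl : log (4 * β * (1 - β)) ≤ log (4 * β) :=
    log_le_log (by nlinarith) (by nlinarith)
  -- the maximum over `α` of `α (1 + (q / 2) log (4 β) - log α)` is `(4 β) ^ (q / 2)`
  have hG := mul_log_div_le h0 (exp_pos (q / 2 * log (4 * β)))
  rw [log_exp] at hG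
  have hE : exp (q / 2 * log (4 * β)) ≤ 8 * β * √β := by
    have hneg : log (4 * β) ≤ 0 := log_nonpos (by linarith) (by linarith)
    calc exp (q / 2 * log (4 * β)) ≤ exp (log (4 * β) + log (4 * β) / 2) := by
          apply exp_le_exp.2; nlinarith
      _ = 4 * β * √(4 * β) := by
          rw [exp_add, exp_log (by linarith), ← log_sqrt (by linarith),
            exp_log (sqrt_pos.2 (by linarith))]
      _ = 8 * β * √β := by
          rw [sqrt_mul (by norm_num), show (4:ℝ) = 2 ^ 2 by norm_num,
            sqrt_sq (by norm_num)]; ring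
  have hA : binEntropy α / q + α / 2 * log (4 * β) ≤ 8 / 3 * β * √β := by
    have : binEntropy α / q + α / 2 * log (4 * β)
        = (binEntropy α + α * (q / 2 * log (4 * β))) / q := by field_simp
    rw [this, div_le_iff₀ hq0]
    have : 0 ≤ β * √β := by positivity
    nlinarith
  unfold extExponent
  have := mul_le_mul_of_nonneg_left hl (show 0 ≤ α / 2 by linarith)
  linarith

/-- For `ρ` bounded away from `1 / 2` and small `β`, the exponent is at most a negative multiple
of `β`. -/
theorem exists_extExponent_le_neg {q : ℕ} (hq : 3 ≤ q) {r : ℝ} (hr0 : 0 < r) (hr : r < 1 / 2) :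
    ∃ ε > 0, ∃ c > 0, ∀ α β ρ : ℝ, 0 ≤ α → α ≤ 2 * β → 0 < β → β ≤ ε → β ≤ 2 * ρ → ρ ≤ r →
      extExponent q α β ρ ≤ -(c * β) := by
  set κ := -(1 / 2 * log (4 * r * (1 - r))) with hκ
  have hκ0 : 0 < κ := by
    have := log_neg (by nlinarith : 0 < 4 * r * (1 - r)) (four_mul_mul_lt_one hr)
    linarith
  -- the second bound on `ε` gives `8 / 3 * √β ≤ κ / 2`
  refine ⟨min (1 / 4) ((3 * κ / 16) ^ 2), by positivity, κ / 2, by positivity, ?_⟩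
  intro α β ρ h0 h1 hβ hβε h2 hρ
  have hs : √β ≤ 3 * κ / 16 := by
    rw [← sqrt_sq (by positivity : 0 ≤ 3 * κ / 16)]
    exact sqrt_le_sqrt (hβε.trans (min_le_right _ _))
  refine (extExponent_le hq h0 h1 hβ (hβε.trans (min_le_left _ _)) h2 (by linarith)).trans ?_
  have hl : log (4 * ρ * (1 - ρ)) ≤ log (4 * r * (1 - r)) :=
    log_le_log (by nlinarith) (by nlinarith)
  have : 8 / 3 * √β + 1 / 2 * log (4 * ρ * (1 - ρ)) ≤ -(κ / 2) := by linarith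
  nlinarith

theorem accExponent_lt_right {β ρ ρ' : ℝ} (hβ : 0 < β) (h1 : β ≤ 2 * ρ) (h2 : ρ < ρ')
    (h3 : ρ' ≤ 1 / 2) : accExponent β ρ < accExponent β ρ' := by
  have hmono : StrictMonoOn (fun y => accExponent β y) (Set.Icc ρ ρ') := by
    refine strictMonoOn_of_hasDerivWithinAt_pos (convex_Icc _ _)
      (f' := fun y => log (1 - y - β / 2) - log (y - β / 2) + log y - log (1 - y))
      (continuous_accExponent.comp (by fun_prop : Continuous fun y : ℝ => (β, y))).continuousOn
      ?_ ?_
    · intro y hy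
      rw [interior_Icc] at hy
      exact (hasDerivAt_accExponent_right hβ.le (by linarith [hy.1])
        (by linarith [hy.2, hy.1])).hasDerivWithinAt
    · intro y hy
      rw [interior_Icc] at hy
      obtain ⟨hy1, hy2⟩ := hy
      have hb : 0 < y - β / 2 := by linarith
      have hc : 0 < 1 - y - β / 2 := by linarith
      have hy0 : 0 < y := by linarith
      have : log ((y - β / 2) * (1 - y)) < log ((1 - y - β / 2) * y) :=
        log_lt_log (by apply mul_pos <;> linarith) (by nlinarith)
      rw [log_mul hb.ne' (by linarith), log_mul hc.ne' hy0.ne'] at this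
      linarith
  exact hmono (Set.left_mem_Icc.2 h2.le) (Set.right_mem_Icc.2 h2.le) h2

end

/-! ### Stationary points and maxima -/

section

open Real Filter Topology

theorem hasDerivAt_extExponent_left {q : ℕ} {α β : ℝ} (ρ : ℝ) (h0 : 0 < α)
    (h1 : α < 2 * β) (h2 : α < 2 * (1 - β)) :
    HasDerivAt (fun a => extExponent q a β ρ)
      (1 / 2 * (log (4 * (β - α / 2) * (1 - β - α / 2) / (1 - α) ^ 2)
        - log ((α / (1 - α)) ^ ((2 : ℝ) / q)))) α := by
  have hα : 0 < 1 - α := by linarith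
  have := (((hasDerivAt_binEntropy h0.ne' (by linarith : α ≠ 1)).div_const (q : ℝ)).add
    (hasDerivAt_accExponent_left (by linarith : 0 < β - α / 2)
      (by linarith : 0 < 1 - β - α / 2))).add_const (accExponent β ρ)
  refine this.congr_deriv ?_
  rw [log_rpow (by positivity), log_div h0.ne' hα.ne']
  ring

theorem hasDerivAt_extExponent_right {q : ℕ} {α β ρ : ℝ} (h0 : 0 < α)
    (h1 : α < 2 * β) (h2 : α < 2 * (1 - β)) (h3 : β < 2 * ρ) (hρ : ρ ≤ 1 / 2) :
    HasDerivAt (fun b => extExponent q α b ρ)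
      (1 / 2 * (log (4 * (ρ - β / 2) * (1 - ρ - β / 2) / (1 - β) ^ 2)
        - log (((1 - β) / β * ((β - α / 2) / (1 - β - α / 2))) ^ 2))) β := by
  have hb : 0 < β - α / 2 := by linarith
  have hc : 0 < 1 - β - α / 2 := by linarith
  have hβ : 0 < β := by linarith
  have hβ' : 0 < 1 - β := by linarith
  have := ((hasDerivAt_accExponent_right h0.le hb hc).const_add (binEntropy α / q)).add
    (hasDerivAt_accExponent_left (by linarith : 0 < ρ - β / 2)
      (by linarith : 0 < 1 - ρ - β / 2))
  refine this.congr_deriv ?_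
  rw [log_pow, log_mul (by positivity) (by positivity), log_div hβ'.ne' hβ.ne',
    log_div hb.ne' hc.ne']
  push_cast
  ring

theorem mem_interior_raaRegion {ρ : ℝ} (hρ : ρ ≤ 1 / 2) {α β : ℝ} :
    (α, β) ∈ interior (raaRegion ρ) ↔ 0 < α ∧ α < 2 * β ∧ α < 2 * (1 - β) ∧ β < 2 * ρ := by
  constructor
  · intro h
    have hn := mem_interior_iff_mem_nhds.1 h
    have key : ∀ g : ℝ → ℝ × ℝ, Continuous g → g 0 = (α, β) →
        ∃ t > 0, g t ∈ raaRegion ρ := by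
      intro g hg h0
      have ht : Tendsto g (𝓝[>] 0) (𝓝 (α, β)) := h0 ▸ (hg.tendsto 0).mono_left nhdsWithin_le_nhds
      have := (ht.eventually_mem hn).and self_mem_nhdsWithin
      obtain ⟨t, ht1, ht2⟩ := this.exists
      exact ⟨t, ht2, ht1⟩
    obtain ⟨t, ht, h1⟩ := key (fun t => (α + t, β)) (by fun_prop) (by simp)
    obtain ⟨s, hs, h2⟩ := key (fun t => (α, β + t)) (by fun_prop) (by simp)
    rw [mem_raaRegion hρ] at h1 h2
    exact ⟨h2.1, by linarith [h1.2.1], by linarith [h1.2.2.1], by linarith [h2.2.2.2]⟩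
  · rintro ⟨h0, h1, h2, h3⟩
    refine mem_interior.2 ⟨{p : ℝ × ℝ | 0 < p.1 ∧ p.1 < 2 * p.2 ∧ p.1 < 2 * (1 - p.2) ∧
      p.2 < 2 * ρ}, ?_, ?_, h0, h1, h2, h3⟩
    · rintro ⟨a, b⟩ ⟨h0, h1, h2, h3⟩
      exact (mem_raaRegion hρ).2 ⟨h0, h1.le, h2.le, h3.le⟩
    · have o1 : IsOpen {p : ℝ × ℝ | 0 < p.1} := isOpen_lt (by fun_prop) (by fun_prop)
      have o2 : IsOpen {p : ℝ × ℝ | p.1 < 2 * p.2} := isOpen_lt (by fun_prop) (by fun_prop)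
      have o3 : IsOpen {p : ℝ × ℝ | p.1 < 2 * (1 - p.2)} := isOpen_lt (by fun_prop) (by fun_prop)
      have o4 : IsOpen {p : ℝ × ℝ | p.2 < 2 * ρ} := isOpen_lt (by fun_prop) (by fun_prop)
      exact o1.inter (o2.inter (o3.inter o4))

/-- The equations of the stationary points are quadratic in `z`; the root `z ≤ 1 / 2` is taken. -/
theorem quadratic_eq_iff {x z Y : ℝ} (hx : x < 1) (hz : z ≤ 1 / 2) (hY : Y ≤ 1) :
    4 * (z - x / 2) * (1 - z - x / 2) / (1 - x) ^ 2 = Y ↔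
      z = 1 / 2 - (1 - x) / 2 * √(1 - Y) := by
  have ht : 0 < 1 - x := by linarith
  have hs : √(1 - Y) ^ 2 = 1 - Y := sq_sqrt (by linarith)
  rw [div_eq_iff (by positivity)]
  constructor
  · intro h
    have h1 : (1 - 2 * z) ^ 2 = ((1 - x) * √(1 - Y)) ^ 2 := by rw [mul_pow, hs]; linarith
    have := (sq_eq_sq₀ (by linarith) (by positivity)).1 h1
    linarith
  · intro h
    have : (1 - 2 * z) = (1 - x) * √(1 - Y) := by linarith
    have h1 : (1 - 2 * z) ^ 2 = ((1 - x) * √(1 - Y)) ^ 2 := by rw [this]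
    rw [mul_pow, hs] at h1
    linarith

theorem quadratic_le_one {x z : ℝ} (hx : x < 1) :
    4 * (z - x / 2) * (1 - z - x / 2) / (1 - x) ^ 2 ≤ 1 := by
  rw [div_le_one (by nlinarith)]
  nlinarith [sq_nonneg (1 - 2 * z)]

/-- The system, with the square roots removed: each equation says that the argument of the logarithm
in a partial derivative equals one. The conditions `α ≤ 1 / 2` and `β ≤ 1 / 2`, which select the
roots, follow from these equations in the interior of the region. -/
theorem raaSystem_iff {q : ℕ} (hq : 0 < q) {α β ρ : ℝ} (hρ : ρ ≤ 1 / 2) :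
    RaaSystem q α β ρ ↔ (0 < α ∧ α < 2 * β ∧ α < 2 * (1 - β) ∧ β < 2 * ρ) ∧
      4 * (β - α / 2) * (1 - β - α / 2) / (1 - α) ^ 2 = (α / (1 - α)) ^ ((2 : ℝ) / q) ∧
      4 * (ρ - β / 2) * (1 - ρ - β / 2) / (1 - β) ^ 2
        = ((1 - β) / β * ((β - α / 2) / (1 - β - α / 2))) ^ 2 := by
  have hq' : (0 : ℝ) < 2 / q := by positivity
  constructor
  · rintro ⟨h0, h1, hβ, hρe⟩
    have hα : 0 < 1 - α := by linarith
    have hY0 : 0 < (α / (1 - α)) ^ ((2 : ℝ) / q) := by positivity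
    have hY1 : (α / (1 - α)) ^ ((2 : ℝ) / q) ≤ 1 :=
      rpow_le_one (by positivity) ((div_le_one hα).2 (by linarith)) hq'.le
    have hs0 := sqrt_nonneg (1 - (α / (1 - α)) ^ ((2 : ℝ) / q))
    have hs1 : √(1 - (α / (1 - α)) ^ ((2 : ℝ) / q)) < 1 :=
      (sqrt_lt' one_pos).2 (by linarith)
    have hβ1 : β ≤ 1 / 2 := by nlinarith
    have hβ2 : α < 2 * β := by nlinarith
    have hb : 0 < β - α / 2 := by linarith
    have hc : 0 < 1 - β - α / 2 := by linarith
    have hβ0 : 0 < β := by linarith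
    have hβ' : 0 < 1 - β := by linarith
    have hZ0 : 0 < ((1 - β) / β * ((β - α / 2) / (1 - β - α / 2))) ^ 2 := by positivity
    have hZ1 : ((1 - β) / β * ((β - α / 2) / (1 - β - α / 2))) ^ 2 ≤ 1 := by
      refine pow_le_one₀ (by positivity) ?_
      rw [div_mul_div_comm, div_le_one (by positivity)]
      nlinarith
    have hs2 : √(1 - ((1 - β) / β * ((β - α / 2) / (1 - β - α / 2))) ^ 2) < 1 :=
      (sqrt_lt' one_pos).2 (by linarith)
    have hβ3 : β < 2 * ρ := by nlinarith
    exact ⟨⟨h0, hβ2, by linarith, hβ3⟩, (quadratic_eq_iff (by linarith) hβ1 hY1).2 hβ,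
      (quadratic_eq_iff (by linarith) hρ hZ1).2 hρe⟩
  · rintro ⟨⟨h0, h1, h2, h3⟩, e1, e2⟩
    have hα : 0 < 1 - α := by linarith
    have hb : 0 < β - α / 2 := by linarith
    have hc : 0 < 1 - β - α / 2 := by linarith
    have hβ0 : 0 < β := by linarith
    have hβ' : 0 < 1 - β := by linarith
    have hY1 : (α / (1 - α)) ^ ((2 : ℝ) / q) ≤ 1 := e1 ▸ quadratic_le_one (by linarith)
    have hZ1 : ((1 - β) / β * ((β - α / 2) / (1 - β - α / 2))) ^ 2 ≤ 1 :=
      e2 ▸ quadratic_le_one (by linarith)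
    have hα1 : α ≤ 1 / 2 := by
      by_contra! h
      have : 1 < α / (1 - α) := (one_lt_div hα).2 (by linarith)
      exact absurd hY1 (not_le.2 (one_lt_rpow this hq'))
    have hβ1 : β ≤ 1 / 2 := by
      have h := (sq_le_one_iff₀ (by positivity)).1 hZ1
      rw [div_mul_div_comm, div_le_one (by positivity)] at h
      nlinarith
    exact ⟨h0, hα1, (quadratic_eq_iff (by linarith) hβ1 hY1).1 e1,
      (quadratic_eq_iff (by linarith) hρ hZ1).1 e2⟩

theorem raaSystem_iff_hasDerivAt_ext {q : ℕ} (hq : 0 < q) {α β ρ : ℝ} (hρ : ρ ≤ 1 / 2) :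
    RaaSystem q α β ρ ↔ (α, β) ∈ interior (raaRegion ρ) ∧
      HasDerivAt (fun a => extExponent q a β ρ) 0 α ∧
      HasDerivAt (fun b => extExponent q α b ρ) 0 β := by
  rw [raaSystem_iff hq hρ, mem_interior_raaRegion hρ]
  refine and_congr_right ?_
  rintro ⟨h0, h1, h2, h3⟩
  have hα : 0 < 1 - α := by linarith
  have hb : 0 < β - α / 2 := by linarith
  have hc : 0 < 1 - β - α / 2 := by linarith
  have hβ0 : 0 < β := by linarith
  have hβ' : 0 < 1 - β := by linarith
  have hb' : 0 < ρ - β / 2 := by linarith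
  have hc' : 0 < 1 - ρ - β / 2 := by linarith
  have key : ∀ {X Y x : ℝ} {g : ℝ → ℝ}, 0 < X → 0 < Y →
      HasDerivAt g (1 / 2 * (log X - log Y)) x → (X = Y ↔ HasDerivAt g 0 x) := by
    intro X Y x g hX hY hg
    constructor
    · rintro rfl; simpa using hg
    · intro h
      have := hg.unique h
      exact log_injOn_pos hX hY (by linarith)
  exact and_congr
    (key (by positivity) (by positivity) (hasDerivAt_extExponent_left ρ h0 h1 h2))
    (key (by positivity) (by positivity) (hasDerivAt_extExponent_right h0 h1 h2 h3 hρ))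

theorem raaSystem_iff_stationary {q : ℕ} (hq : 0 < q) {α β ρ : ℝ} (hρ : ρ ≤ 1 / 2) :
    RaaSystem q α β ρ ↔ (α, β) ∈ interior (raaRegion ρ) ∧
      HasDerivAt (fun a => raaExponent q a β ρ) 0 α ∧
      HasDerivAt (fun b => raaExponent q α b ρ) 0 β := by
  rw [raaSystem_iff_hasDerivAt_ext hq hρ]
  refine and_congr_right fun h => ?_
  obtain ⟨h0, h1, h2, h3⟩ := (mem_interior_raaRegion hρ).1 h
  have hα : α ≠ 1 := by linarith
  have hβ : β ≠ 1 := by linarith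
  refine and_congr (EventuallyEq.hasDerivAt_iff ?_) (EventuallyEq.hasDerivAt_iff ?_)
  · filter_upwards [isOpen_ne.mem_nhds hα] with a ha using (raaExponent_eq_ext ha hβ ρ).symm
  · filter_upwards [isOpen_ne.mem_nhds hβ] with b hb using (raaExponent_eq_ext hα hb ρ).symm

/-- A function whose derivative is negative to the left of `b` does not have its maximum at `b`. -/
theorem eventually_lt_of_deriv_neg {φ φ' : ℝ → ℝ} {b : ℝ} (hφ : Continuous φ)
    (h : ∀ᶠ t in 𝓝[<] b, HasDerivAt φ (φ' t) t ∧ φ' t < 0) : ∀ᶠ t in 𝓝[<] b, φ b < φ t := by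
  obtain ⟨l, hl, hl'⟩ := mem_nhdsLT_iff_exists_Ioo_subset.1 h
  filter_upwards [Ioo_mem_nhdsLT hl] with t ht
  have : StrictAntiOn φ (Set.Icc t b) := by
    refine strictAntiOn_of_hasDerivWithinAt_neg (convex_Icc _ _) (f' := φ') hφ.continuousOn ?_ ?_
    · intro x hx
      rw [interior_Icc] at hx
      exact (hl' ⟨ht.1.trans hx.1, hx.2⟩).1.hasDerivWithinAt
    · intro x hx
      rw [interior_Icc] at hx
      exact (hl' ⟨ht.1.trans hx.1, hx.2⟩).2
  exact this (Set.left_mem_Icc.2 ht.2.le) (Set.right_mem_Icc.2 ht.2.le) ht.2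

theorem continuous_extExponent_left (q : ℕ) (β ρ : ℝ) :
    Continuous fun a => extExponent q a β ρ :=
  (continuous_extExponent q).comp (by fun_prop : Continuous fun a : ℝ => (a, β, ρ))

theorem continuous_extExponent_mid (q : ℕ) (α ρ : ℝ) :
    Continuous fun b => extExponent q α b ρ :=
  (continuous_extExponent q).comp (by fun_prop : Continuous fun b : ℝ => (α, b, ρ))

/-- The exponent decreases in `α` towards the part of the boundary where `α = 2 * min β (1 - β)`. -/
theorem eventually_extExponent_lt_left {q : ℕ} (hq : 0 < q) {α β : ℝ} (ρ : ℝ) (h0 : 0 < α)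
    (h1 : α ≤ 2 * β) (h2 : α ≤ 2 * (1 - β)) (h : α = 2 * β ∨ α = 2 * (1 - β)) :
    ∀ᶠ a in 𝓝[<] α, extExponent q α β ρ < extExponent q a β ρ := by
  have hq' : (0 : ℝ) < 2 / q := by positivity
  refine eventually_lt_of_deriv_neg (continuous_extExponent_left q β ρ)
    (φ' := fun a => 1 / 2 * (log (4 * (β - a / 2) * (1 - β - a / 2) / (1 - a) ^ 2)
        - log ((a / (1 - a)) ^ ((2 : ℝ) / q)))) ?_
  have hlt : ∀ᶠ a in 𝓝[<] α, 4 * (β - a / 2) * (1 - β - a / 2) / (1 - a) ^ 2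
      < (a / (1 - a)) ^ ((2 : ℝ) / q) := by
    rcases (show α ≤ 1 by linarith).eq_or_lt with rfl | hα
    · have hβ : β = 1 / 2 := by rcases h with h | h <;> linarith
      filter_upwards [Ioo_mem_nhdsLT (show (1 / 2 : ℝ) < 1 by norm_num)] with a ha
      refine (quadratic_le_one ha.2).trans_lt (one_lt_rpow ?_ hq')
      rw [one_lt_div (by linarith [ha.2])]
      linarith [ha.1]
    · have hα' : 0 < 1 - α := by linarith
      refine Filter.Eventually.filter_mono nhdsWithin_le_nhds
        (ContinuousAt.eventually_lt ?_ ?_ ?_)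
      · exact ContinuousAt.div (by fun_prop) (by fun_prop) (by positivity)
      · exact ContinuousAt.rpow_const (ContinuousAt.div (by fun_prop) (by fun_prop) hα'.ne')
          (Or.inr hq'.le)
      · have : 4 * (β - α / 2) * (1 - β - α / 2) = 0 := by
          rcases h with h | h <;> rw [h] <;> ring
        rw [this, zero_div]
        positivity
  filter_upwards [hlt, Ioo_mem_nhdsLT h0] with a ha ha'
  have hb : 0 < β - a / 2 := by linarith [ha'.2]
  have hc : 0 < 1 - β - a / 2 := by linarith [ha'.2]
  have hX : 0 < 4 * (β - a / 2) * (1 - β - a / 2) / (1 - a) ^ 2 := by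
    have : 0 < 1 - a := by linarith
    positivity
  exact ⟨hasDerivAt_extExponent_left ρ ha'.1 (by linarith) (by linarith),
    by linarith [log_lt_log hX ha]⟩

/-- The exponent decreases in `β` towards the part of the boundary where `β = 2 * ρ`. -/
theorem eventually_extExponent_lt_right {q : ℕ} {α β ρ : ℝ} (hρ : ρ ≤ 1 / 2) (h0 : 0 < α)
    (h1 : α < 2 * β) (h2 : α < 2 * (1 - β)) (h : β = 2 * ρ) :
    ∀ᶠ b in 𝓝[<] β, extExponent q α β ρ < extExponent q α b ρ := by
  refine eventually_lt_of_deriv_neg (continuous_extExponent_mid q α ρ)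
    (φ' := fun b => 1 / 2 * (log (4 * (ρ - b / 2) * (1 - ρ - b / 2) / (1 - b) ^ 2)
        - log (((1 - b) / b * ((b - α / 2) / (1 - b - α / 2))) ^ 2))) ?_
  have hβ : 0 < β := by linarith
  have hβ' : 0 < 1 - β := by linarith
  have hlt : ∀ᶠ b in 𝓝[<] β, 4 * (ρ - b / 2) * (1 - ρ - b / 2) / (1 - b) ^ 2
      < ((1 - b) / b * ((b - α / 2) / (1 - b - α / 2))) ^ 2 := by
    have hb : 0 < β - α / 2 := by linarith
    have hc : 0 < 1 - β - α / 2 := by linarith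
    refine Filter.Eventually.filter_mono nhdsWithin_le_nhds (ContinuousAt.eventually_lt ?_ ?_ ?_)
    · exact ContinuousAt.div (by fun_prop) (by fun_prop) (by positivity)
    · have c1 : ContinuousAt (fun b : ℝ => (1 - b) / b) β :=
        ContinuousAt.div (by fun_prop) (by fun_prop) hβ.ne'
      have c2 : ContinuousAt (fun b : ℝ => (b - α / 2) / (1 - b - α / 2)) β :=
        ContinuousAt.div (by fun_prop) (by fun_prop) hc.ne'
      exact (c1.mul c2).pow 2
    · have : 4 * (ρ - β / 2) * (1 - ρ - β / 2) = 0 := by rw [h]; ring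
      rw [this, zero_div]
      positivity
  filter_upwards [hlt, Ioo_mem_nhdsLT (show max (α / 2) 0 < β from max_lt (by linarith) hβ)]
    with b hb hb'
  have hb1 := (le_max_left _ _).trans_lt hb'.1
  have hb2 := hb'.2
  have hX : 0 < 4 * (ρ - b / 2) * (1 - ρ - b / 2) / (1 - b) ^ 2 := by
    have : 0 < 1 - b := by linarith
    have : 0 < ρ - b / 2 := by linarith
    have : 0 < 1 - ρ - b / 2 := by linarith
    positivity
  exact ⟨hasDerivAt_extExponent_right h0 (by linarith) (by linarith) (by linarith) hρ,
    by linarith [log_lt_log hX hb]⟩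

theorem raaSystem_of_isMaxOn {q : ℕ} (hq : 0 < q) {ρ : ℝ} (hρ : ρ ≤ 1 / 2) {p : ℝ × ℝ}
    (hp : p ∈ raaRegion ρ)
    (hmax : IsMaxOn (fun p : ℝ × ℝ => raaExponent q p.1 p.2 ρ) (raaRegion ρ) p) :
    RaaSystem q p.1 p.2 ρ := by
  obtain ⟨α, β⟩ := p
  have hext : ∀ a b : ℝ, (a, b) ∈ raaRegion ρ → extExponent q a b ρ ≤ extExponent q α β ρ := by
    intro a b hab
    have := hmax hab
    simp only [Set.mem_ofPred_eq] at this
    rwa [raaExponent_eq_ext_of_mem hρ hab, raaExponent_eq_ext_of_mem hρ hp] at this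
  obtain ⟨h0, h1, h2, h3⟩ := (mem_raaRegion hρ).1 hp
  -- the boundary in `α` comes first: the derivative in `β` exists only away from it
  have hA : ¬ (α = 2 * β ∨ α = 2 * (1 - β)) := by
    intro h
    obtain ⟨a, ha1, ha2⟩ := ((eventually_extExponent_lt_left hq ρ h0 h1 h2 h).and
      (Ioo_mem_nhdsLT h0)).exists
    have := hext a β ((mem_raaRegion hρ).2
      ⟨ha2.1, by linarith [ha2.2], by linarith [ha2.2], h3⟩)
    linarith
  push Not at hA
  replace h1 := lt_of_le_of_ne h1 hA.1
  replace h2 := lt_of_le_of_ne h2 hA.2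
  have hB : β ≠ 2 * ρ := by
    intro h
    obtain ⟨b, hb1, hb2⟩ := ((eventually_extExponent_lt_right (q := q) hρ h0 h1 h2 h).and
      (Ioo_mem_nhdsLT (show α / 2 < β by linarith))).exists
    have := hext α b ((mem_raaRegion hρ).2
      ⟨h0, by linarith [hb2.1], by linarith [hb2.2], by linarith [hb2.2]⟩)
    linarith
  replace h3 := lt_of_le_of_ne h3 hB
  have hint := (mem_interior_raaRegion hρ).2 ⟨h0, h1, h2, h3⟩
  have hn := mem_interior_iff_mem_nhds.1 hint
  rw [raaSystem_iff_hasDerivAt_ext hq hρ]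
  refine ⟨hint, ?_, ?_⟩
  · have hd := hasDerivAt_extExponent_left (q := q) ρ h0 h1 h2
    have hl : IsLocalMax (fun a => extExponent q a β ρ) α := by
      have hc : Tendsto (fun a : ℝ => (a, β)) (𝓝 α) (𝓝 (α, β)) :=
        (by fun_prop : Continuous fun a : ℝ => (a, β)).tendsto α
      filter_upwards [hc.eventually_mem hn] with a ha using hext a β ha
    rwa [hl.hasDerivAt_eq_zero hd] at hd
  · have hd := hasDerivAt_extExponent_right (q := q) h0 h1 h2 h3 hρ
    have hl : IsLocalMax (fun b => extExponent q α b ρ) β := by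
      have hc : Tendsto (fun b : ℝ => (α, b)) (𝓝 β) (𝓝 (α, β)) :=
        (by fun_prop : Continuous fun b : ℝ => (α, b)).tendsto β
      filter_upwards [hc.eventually_mem hn] with b hb using hext α b hb
    rwa [hl.hasDerivAt_eq_zero hd] at hd

end

/-! ### Existence of maxima and the threshold -/

section

open Real Filter Topology

theorem accExponent_nonpos {β ρ : ℝ} (h0 : 0 ≤ β) (h1 : β ≤ 2 * ρ) (hρ0 : 0 < ρ)
    (hρ : ρ ≤ 1 / 2) : accExponent β ρ ≤ 0 := by
  refine (accExponent_le h0 (by linarith) (by linarith) hρ0 (by linarith)).trans ?_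
  have : log (4 * ρ * (1 - ρ)) ≤ 0 :=
    log_nonpos (by nlinarith) (by nlinarith [sq_nonneg (1 - 2 * ρ)])
  exact mul_nonpos_of_nonneg_of_nonpos (by linarith) this

theorem extExponent_zero_left (q : ℕ) (β ρ : ℝ) :
    extExponent q 0 β ρ = accExponent β ρ := by
  simp [extExponent, accExponent_zero_left]

/-- The exponent is nonpositive for `α = 0`, the part of the boundary that `raaRegion ρ` does not
contain. Hence its maximum over the closure is attained in the region if it is positive anywhere. -/
theorem exists_isGreatest_raaValues {q : ℕ} {ρ y : ℝ} (hρ0 : 0 < ρ) (hρ : ρ ≤ 1 / 2)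
    (hy : y ∈ raaValues q ρ) (hy0 : 0 < y) : ∃ m, y ≤ m ∧ IsGreatest (raaValues q ρ) m := by
  obtain ⟨⟨a, b⟩, hab, rfl⟩ := hy
  simp only at hy0 ⊢
  set S : Set (ℝ × ℝ) := {p | 0 ≤ p.1 ∧ p.1 ≤ 2 * p.2 ∧ p.1 ≤ 2 * (1 - p.2) ∧ p.2 ≤ 2 * ρ} with hS
  have hcl : IsClosed S := by
    have o1 : IsClosed {p : ℝ × ℝ | 0 ≤ p.1} := isClosed_le (by fun_prop) (by fun_prop)
    have o2 : IsClosed {p : ℝ × ℝ | p.1 ≤ 2 * p.2} := isClosed_le (by fun_prop) (by fun_prop)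
    have o3 : IsClosed {p : ℝ × ℝ | p.1 ≤ 2 * (1 - p.2)} :=
      isClosed_le (by fun_prop) (by fun_prop)
    have o4 : IsClosed {p : ℝ × ℝ | p.2 ≤ 2 * ρ} := isClosed_le (by fun_prop) (by fun_prop)
    exact o1.inter (o2.inter (o3.inter o4))
  have hco : IsCompact S := by
    refine IsCompact.of_isClosed_subset (isCompact_Icc (a := ((0 : ℝ), (0 : ℝ)))
      (b := ((1 : ℝ), (1 : ℝ)))) hcl ?_
    rintro ⟨x, y⟩ ⟨h0, h1, h2, h3⟩
    simp only at h0 h1 h2 h3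
    exact ⟨⟨h0, by simp only; linarith⟩, ⟨by simp only; linarith, by simp only; linarith⟩⟩
  have hsub : raaRegion ρ ⊆ S := by
    rintro ⟨x, y⟩ h
    obtain ⟨h0, h⟩ := (mem_raaRegion hρ).1 h
    exact ⟨h0.le, h⟩
  obtain ⟨⟨α, β⟩, hp, hmax⟩ := hco.exists_isMaxOn ⟨_, hsub hab⟩
    (f := fun p : ℝ × ℝ => extExponent q p.1 p.2 ρ)
    ((continuous_extExponent q).comp
      (by fun_prop : Continuous fun p : ℝ × ℝ => (p.1, p.2, ρ))).continuousOn
  have hle : ∀ x z, (x, z) ∈ raaRegion ρ → raaExponent q x z ρ ≤ extExponent q α β ρ := by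
    intro x z h
    rw [raaExponent_eq_ext_of_mem hρ h]
    exact hmax (hsub h)
  obtain ⟨h0, h1, h2, h3⟩ := hp
  simp only at h0 h1 h2 h3
  have hα : α ≠ 0 := by
    rintro rfl
    have h4 := hle a b hab
    rw [extExponent_zero_left] at h4
    linarith [accExponent_nonpos (by linarith) h3 hρ0 hρ]
  have hmem : (α, β) ∈ raaRegion ρ := (mem_raaRegion hρ).2 ⟨h0.lt_of_ne' hα, h1, h2, h3⟩
  refine ⟨extExponent q α β ρ, hle a b hab, ⟨(α, β), hmem, raaExponent_eq_ext_of_mem hρ hmem⟩, ?_⟩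
  rintro _ ⟨⟨x, z⟩, h, rfl⟩
  exact hle x z h

theorem raaSystemValues_subset {q : ℕ} (hq : 0 < q) {ρ : ℝ} (hρ : ρ ≤ 1 / 2) :
    raaSystemValues q ρ ⊆ raaValues q ρ := by
  rintro _ ⟨α, β, h, rfl⟩
  exact ⟨(α, β), interior_subset ((raaSystem_iff_stationary hq hρ).1 h).1, rfl⟩

theorem isGreatest_raaSystemValues {q : ℕ} (hq : 0 < q) {ρ m : ℝ} (hρ : ρ ≤ 1 / 2)
    (h : IsGreatest (raaValues q ρ) m) : IsGreatest (raaSystemValues q ρ) m := by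
  obtain ⟨⟨p, hp, rfl⟩, hmax⟩ := h
  exact ⟨⟨p.1, p.2, raaSystem_of_isMaxOn hq hρ hp fun x hx => hmax ⟨x, hx, rfl⟩, rfl⟩,
    fun y hy => hmax (raaSystemValues_subset hq hρ hy)⟩

theorem isGreatest_raaValues_iff {q : ℕ} (hq : 0 < q) {ρ m : ℝ} (hρ0 : 0 < ρ) (hρ : ρ ≤ 1 / 2)
    (hm : 0 ≤ m) : IsGreatest (raaValues q ρ) m ↔ IsGreatest (raaSystemValues q ρ) m := by
  refine ⟨isGreatest_raaSystemValues hq hρ, fun h => ⟨raaSystemValues_subset hq hρ h.1, ?_⟩⟩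
  intro y hy
  by_contra! hlt
  obtain ⟨M, hM, hG⟩ := exists_isGreatest_raaValues hρ0 hρ hy (hm.trans_lt hlt)
  have := h.2 (isGreatest_raaSystemValues hq hρ hG).1
  linarith

theorem raaRegion_mono {ρ ρ' : ℝ} (h : ρ ≤ ρ') (hρ' : ρ' ≤ 1 / 2) :
    raaRegion ρ ⊆ raaRegion ρ' := by
  rintro ⟨α, β⟩ hp
  rw [mem_raaRegion (h.trans hρ')] at hp
  rw [mem_raaRegion hρ']
  exact ⟨hp.1, hp.2.1, hp.2.2.1, by linarith [hp.2.2.2]⟩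

theorem raaExponent_lt_of_lt {q : ℕ} {α β ρ ρ' : ℝ} (h : (α, β) ∈ raaRegion ρ) (hlt : ρ < ρ')
    (hρ' : ρ' ≤ 1 / 2) : raaExponent q α β ρ < raaExponent q α β ρ' := by
  rw [raaExponent_eq_ext_of_mem (hlt.le.trans hρ') h,
    raaExponent_eq_ext_of_mem hρ' (raaRegion_mono hlt.le hρ' h)]
  obtain ⟨h0, h1, h2, h3⟩ := (mem_raaRegion (hlt.le.trans hρ')).1 h
  have := accExponent_lt_right (by linarith : 0 < β) h3 hlt hρ'
  unfold extExponent
  linarith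

theorem eventually_extExponent_half_pos {q : ℕ} (hq : 0 < q) :
    ∀ᶠ ρ in 𝓝[<] (1 / 2 : ℝ), 0 < extExponent q (1 / 2) (1 / 2) ρ := by
  have hc : Continuous fun ρ => extExponent q (1 / 2) (1 / 2) ρ :=
    (continuous_extExponent q).comp
      (by fun_prop : Continuous fun ρ : ℝ => ((1 / 2 : ℝ), (1 / 2 : ℝ), ρ))
  refine (continuous_const.tendsto _ |>.eventually_lt (hc.tendsto _) ?_).filter_mono
    nhdsWithin_le_nhds
  have hJ : accExponent (1 / 2) (1 / 2) = 0 := by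
    have h2 : log (1 / 2) = -log 2 := by rw [one_div, log_inv]
    have h4 : log (1 / 4) = -(2 * log 2) := by
      rw [one_div, log_inv, show (4 : ℝ) = 2 ^ 2 by norm_num, log_pow]
      push_cast
      ring
    unfold accExponent negMulLog
    norm_num [h2, h4]
    ring
  have : 0 < log 2 := log_pos one_lt_two
  rw [extExponent, hJ, one_div, binEntropy_two_inv]
  positivity

theorem isCompact_closedRegion (ε : ℝ) {r : ℝ} (hr : r ≤ 1 / 2) :
    IsCompact {p : ℝ × ℝ × ℝ | 0 ≤ p.1 ∧ p.1 ≤ 2 * p.2.1 ∧ p.1 ≤ 2 * (1 - p.2.1) ∧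
      ε ≤ p.2.1 ∧ p.2.1 ≤ 2 * p.2.2 ∧ p.2.2 ≤ r} := by
  set T : Set (ℝ × ℝ × ℝ) := {p | 0 ≤ p.1 ∧ p.1 ≤ 2 * p.2.1 ∧ p.1 ≤ 2 * (1 - p.2.1) ∧
    ε ≤ p.2.1 ∧ p.2.1 ≤ 2 * p.2.2 ∧ p.2.2 ≤ r} with hT
  have hcl : IsClosed T := by
    have o1 : IsClosed {p : ℝ × ℝ × ℝ | 0 ≤ p.1} := isClosed_le (by fun_prop) (by fun_prop)
    have o2 : IsClosed {p : ℝ × ℝ × ℝ | p.1 ≤ 2 * p.2.1} :=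
      isClosed_le (by fun_prop) (by fun_prop)
    have o3 : IsClosed {p : ℝ × ℝ × ℝ | p.1 ≤ 2 * (1 - p.2.1)} :=
      isClosed_le (by fun_prop) (by fun_prop)
    have o4 : IsClosed {p : ℝ × ℝ × ℝ | ε ≤ p.2.1} := isClosed_le (by fun_prop) (by fun_prop)
    have o5 : IsClosed {p : ℝ × ℝ × ℝ | p.2.1 ≤ 2 * p.2.2} :=
      isClosed_le (by fun_prop) (by fun_prop)
    have o6 : IsClosed {p : ℝ × ℝ × ℝ | p.2.2 ≤ r} := isClosed_le (by fun_prop) (by fun_prop)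
    exact o1.inter (o2.inter (o3.inter (o4.inter (o5.inter o6))))
  refine IsCompact.of_isClosed_subset (isCompact_Icc (a := ((0 : ℝ), (0 : ℝ), (0 : ℝ)))
      (b := ((1 : ℝ), (1 : ℝ), (1 : ℝ)))) hcl ?_
  rintro ⟨x, y, z⟩ ⟨h0, h1, h2, h3, h4, h5⟩
  simp only at h0 h1 h2 h3 h4 h5
  exact ⟨⟨h0, by constructor <;> simp only <;> linarith⟩,
    ⟨by simp only; linarith, by constructor <;> simp only <;> linarith⟩⟩

/-- The threshold is the least `ρ` for which the exponent is somewhere nonnegative. The minimum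
exists by compactness, because small `β` are excluded by `exists_extExponent_le_neg`. -/
theorem exists_threshold {q : ℕ} (hq : 3 ≤ q) : ∃ ρhat : ℝ, 0 < ρhat ∧ ρhat < 1 / 2 ∧
    (∀ ρ : ℝ, 0 < ρ → ρ < ρhat → ∀ y ∈ raaValues q ρ, y < 0) ∧ IsGreatest (raaValues q ρhat) 0 := by
  have hq0 : 0 < q := by omega
  obtain ⟨r, hr1, hr2⟩ := ((eventually_extExponent_half_pos hq0).and
    (Ioo_mem_nhdsLT (show (1 / 4 : ℝ) < 1 / 2 by norm_num))).exists
  obtain ⟨ε, hε, c, hc, hneg⟩ := exists_extExponent_le_neg hq (by linarith [hr2.1] : 0 < r) hr2.2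
  set T : Set (ℝ × ℝ × ℝ) := {p | 0 ≤ p.1 ∧ p.1 ≤ 2 * p.2.1 ∧ p.1 ≤ 2 * (1 - p.2.1) ∧
    ε ≤ p.2.1 ∧ p.2.1 ≤ 2 * p.2.2 ∧ p.2.2 ≤ r} ∩
    {p | 0 ≤ extExponent q p.1 p.2.1 p.2.2} with hT
  have hco : IsCompact T := (isCompact_closedRegion ε hr2.2.le).inter_right
    (isClosed_le continuous_const (continuous_extExponent q))
  -- a point of the region with nonnegative exponent and `ρ ≤ r` belongs to `T`
  have hmemT : ∀ α β ρ : ℝ, ρ ≤ r → (α, β) ∈ raaRegion ρ → 0 ≤ raaExponent q α β ρ →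
      (α, β, ρ) ∈ T := by
    intro α β ρ hρ h hF
    have hρ' : ρ ≤ 1 / 2 := by linarith [hr2.2]
    rw [raaExponent_eq_ext_of_mem hρ' h] at hF
    obtain ⟨h0, h1, h2, h3⟩ := (mem_raaRegion hρ').1 h
    refine ⟨⟨h0.le, h1, h2, ?_, h3, hρ⟩, hF⟩
    by_contra! hlt
    have hβ : 0 < β := by linarith
    have := hneg α β ρ h0.le h1 hβ hlt.le h3 hρ
    nlinarith [mul_pos hc hβ]
  have hreg : ((1 / 2 : ℝ), (1 / 2 : ℝ)) ∈ raaRegion r :=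
    (mem_raaRegion hr2.2.le).2 ⟨by norm_num, by norm_num, by norm_num, by linarith [hr2.1]⟩
  have hne : T.Nonempty := ⟨_, hmemT _ _ r le_rfl hreg
    (by rw [raaExponent_eq_ext_of_mem hr2.2.le hreg]; exact hr1.le)⟩
  obtain ⟨⟨α, β, ρ⟩, hp, hmin⟩ := hco.exists_isMinOn hne (f := fun p => p.2.2) (by fun_prop)
  obtain ⟨⟨h0, h1, h2, h3, h4, h5⟩, h6⟩ := hp
  simp only [Set.mem_ofPred_eq] at h0 h1 h2 h3 h4 h5 h6
  have hρ : ρ < 1 / 2 := by linarith [hr2.2]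
  have hβ : 0 < β := by linarith
  have hα : α ≠ 0 := by
    rintro rfl
    rw [extExponent_zero_left] at h6
    linarith [accExponent_neg hβ h4 hρ]
  have hmem : (α, β) ∈ raaRegion ρ := (mem_raaRegion hρ.le).2 ⟨h0.lt_of_ne' hα, h1, h2, h4⟩
  have hbelow : ∀ ρ' : ℝ, 0 < ρ' → ρ' < ρ → ∀ y ∈ raaValues q ρ', y < 0 := by
    rintro ρ' _ hlt _ ⟨⟨a, b⟩, hab, rfl⟩
    by_contra! hF
    have := hmin (hmemT a b ρ' (by linarith) hab hF)
    simp only [Set.mem_ofPred_eq] at this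
    linarith
  rw [← raaExponent_eq_ext_of_mem hρ.le hmem] at h6
  have hub : ∀ y ∈ raaValues q ρ, y ≤ 0 := by
    intro y hy
    by_contra! hpos
    -- a positive maximum is attained in the interior, and stays positive for slightly smaller `ρ`
    obtain ⟨m, hm, hG⟩ := exists_isGreatest_raaValues (by linarith) hρ.le hy hpos
    obtain ⟨⟨a, b, hsys, hab⟩, -⟩ := isGreatest_raaSystemValues hq0 hρ.le hG
    have hint := ((raaSystem_iff_stationary hq0 hρ.le).1 hsys).1
    obtain ⟨g0, g1, g2, g3⟩ := (mem_interior_raaRegion hρ.le).1 hint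
    rw [raaExponent_eq_ext_of_mem hρ.le (interior_subset hint)] at hab
    have hc : Continuous fun ρ => extExponent q a b ρ :=
      (continuous_extExponent q).comp (by fun_prop : Continuous fun ρ : ℝ => (a, b, ρ))
    have hev : ∀ᶠ t in 𝓝[<] ρ, 0 < extExponent q a b t :=
      (continuous_const.tendsto _ |>.eventually_lt (hc.tendsto _)
        (by linarith)).filter_mono nhdsWithin_le_nhds
    obtain ⟨t, ht1, ht2⟩ := (hev.and (Ioo_mem_nhdsLT (show b / 2 < ρ by linarith))).exists
    have htm : (a, b) ∈ raaRegion t :=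
      (mem_raaRegion (by linarith [ht2.2])).2 ⟨g0, g1.le, g2.le, by linarith [ht2.1]⟩
    have := hbelow t (by linarith [ht2.1]) ht2.2 _ ⟨_, htm, rfl⟩
    simp only at this
    rw [raaExponent_eq_ext_of_mem (by linarith [ht2.2]) htm] at this
    linarith
  exact ⟨ρ, by linarith, hρ, hbelow, ⟨(α, β), hmem, (hub _ ⟨_, hmem, rfl⟩).antisymm h6⟩, hub⟩

/-- Below the threshold the exponent is at most a negative multiple of `β` on the closed region,
uniformly in `ρ`. -/
theorem exists_extExponent_le_neg_of_lt_threshold {q : ℕ} (hq : 3 ≤ q) {r : ℝ} (hr0 : 0 < r)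
    (hr : r < 1 / 2) (hneg : ∀ ρ : ℝ, 0 < ρ → ρ ≤ r → ∀ y ∈ raaValues q ρ, y < 0) :
    ∃ c > 0, ∀ α β ρ : ℝ, 0 ≤ α → α ≤ 2 * β → α ≤ 2 * (1 - β) → 0 < β → β ≤ 2 * ρ → ρ ≤ r →
      extExponent q α β ρ ≤ -(c * β) := by
  obtain ⟨ε, hε, c, hc, hsmall⟩ := exists_extExponent_le_neg hq hr0 hr
  set T : Set (ℝ × ℝ × ℝ) := {p | 0 ≤ p.1 ∧ p.1 ≤ 2 * p.2.1 ∧ p.1 ≤ 2 * (1 - p.2.1) ∧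
    ε ≤ p.2.1 ∧ p.2.1 ≤ 2 * p.2.2 ∧ p.2.2 ≤ r} with hT
  have hco : IsCompact T := isCompact_closedRegion ε hr.le
  have hTneg : ∀ p ∈ T, extExponent q p.1 p.2.1 p.2.2 < 0 := by
    rintro ⟨α, β, ρ⟩ ⟨h0, h1, h2, h3, h4, h5⟩
    simp only at h0 h1 h2 h3 h4 h5 ⊢
    have hρ : ρ < 1 / 2 := by linarith
    have hβ : 0 < β := by linarith
    rcases h0.eq_or_lt with rfl | hα
    · rw [extExponent_zero_left]
      exact accExponent_neg hβ h4 hρ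
    · have hmem : (α, β) ∈ raaRegion ρ := (mem_raaRegion hρ.le).2 ⟨hα, h1, h2, h4⟩
      rw [← raaExponent_eq_ext_of_mem hρ.le hmem]
      exact hneg ρ (by linarith) h5 _ ⟨_, hmem, rfl⟩
  obtain ⟨d, hd, hTd⟩ : ∃ d > 0, ∀ p ∈ T, extExponent q p.1 p.2.1 p.2.2 ≤ -d := by
    rcases T.eq_empty_or_nonempty with h | h
    · exact ⟨1, one_pos, by simp [h]⟩
    · obtain ⟨p, hp, hmax⟩ := hco.exists_isMaxOn h (continuous_extExponent q).continuousOn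
      exact ⟨-extExponent q p.1 p.2.1 p.2.2, by linarith [hTneg p hp], fun x hx => by
        rw [neg_neg]; exact hmax hx⟩
  refine ⟨min c d, lt_min hc hd, ?_⟩
  intro α β ρ h0 h1 h2 hβ h4 h5
  rcases le_total β ε with hβε | hβε
  · have h6 := hsmall α β ρ h0 h1 hβ hβε h4 h5
    nlinarith [min_le_left c d]
  · have h6 := hTd (α, β, ρ) ⟨h0, h1, h2, hβε, h4, h5⟩
    simp only at h6
    nlinarith [min_le_right c d, lt_min hc hd]

end

/-! ### Combinatorics of the encoder -/

section

open Finset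

theorem accumulate_eq_sum {N : ℕ} (x : Fin N → ZMod 2) (i : Fin N) :
    accumulate x i = ∑ j, if j ≤ i then x j else 0 := by
  rw [accumulate, ← sum_filter]
  congr 1
  ext j
  simp

theorem accumulate_sub {N : ℕ} (x y : Fin N → ZMod 2) :
    accumulate (x - y) = accumulate x - accumulate y := by
  ext i
  simp [accumulate, sum_sub_distrib]

theorem accumulate_injective {N : ℕ} :
    Function.Injective (accumulate : (Fin N → ZMod 2) → Fin N → ZMod 2) := by
  intro x y h
  ext i
  induction i using WellFoundedLT.induction with
  | ind i ih =>
    have hi := congrFun h i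
    simp only [accumulate] at hi
    rw [← Iio_insert i, sum_insert (by simp), sum_insert (by simp),
      sum_congr rfl fun j hj => ih j (mem_Iio.1 hj)] at hi
    exact add_right_cancel hi

theorem hammingNorm_eq_sum {ι : Type*} [Fintype ι] (x : ι → ZMod 2) :
    hammingNorm x = ∑ i, if x i ≠ 0 then 1 else 0 := by
  rw [hammingNorm, card_filter]

theorem sum_eq_hammingNorm {ι : Type*} [Fintype ι] (x : ι → ZMod 2) :
    ∑ i, x i = (hammingNorm x : ZMod 2) := by
  rw [hammingNorm_eq_sum, Nat.cast_sum]
  refine sum_congr rfl fun i _ => ?_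
  generalize x i = a
  revert a
  decide

theorem accumulate_snoc_castSucc {n : ℕ} (x : Fin n → ZMod 2) (b : ZMod 2) (i : Fin n) :
    accumulate (Fin.snoc x b : Fin (n + 1) → ZMod 2) i.castSucc = accumulate x i := by
  rw [accumulate_eq_sum, accumulate_eq_sum, Fin.sum_univ_castSucc]
  simp

/-- The last bit of the output is the parity of the weight of the input. -/
theorem accumulate_snoc_last {n : ℕ} (x : Fin n → ZMod 2) (b : ZMod 2) :
    accumulate (Fin.snoc x b : Fin (n + 1) → ZMod 2) (Fin.last n)
      = (hammingNorm x : ZMod 2) + b := by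
  rw [accumulate_eq_sum, Fin.sum_univ_castSucc, ← sum_eq_hammingNorm]
  simp [Fin.le_last]

theorem hammingNorm_snoc {n : ℕ} (x : Fin n → ZMod 2) (b : ZMod 2) :
    hammingNorm (Fin.snoc x b : Fin (n + 1) → ZMod 2)
      = hammingNorm x + if b ≠ 0 then 1 else 0 := by
  rw [hammingNorm_eq_sum, Fin.sum_univ_castSucc, hammingNorm_eq_sum]
  simp

theorem hammingNorm_accumulate_snoc {n : ℕ} (x : Fin n → ZMod 2) (b : ZMod 2) :
    hammingNorm (accumulate (Fin.snoc x b : Fin (n + 1) → ZMod 2))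
      = hammingNorm (accumulate x) + if (hammingNorm x : ZMod 2) + b ≠ 0 then 1 else 0 := by
  rw [hammingNorm_eq_sum, Fin.sum_univ_castSucc, hammingNorm_eq_sum]
  simp only [accumulate_snoc_castSucc, accumulate_snoc_last]

/-- The input-output weight enumerator of the accumulator: the number of words of length `n` and
weight `h` that accumulate to a word of weight `d`. -/
def accumulateCount (n h d : ℕ) : ℕ :=
  #{x : Fin n → ZMod 2 | hammingNorm x = h ∧ hammingNorm (accumulate x) = d}

theorem accumulateCount_eq_zero {n d : ℕ} (h : ℕ) (hd : n < d) : accumulateCount n h d = 0 := by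
  rw [accumulateCount, card_eq_zero, filter_eq_empty_iff]
  rintro x - ⟨-, h2⟩
  have := hammingNorm_le_card_fintype (x := accumulate x)
  rw [Fintype.card_fin] at this
  omega

theorem accumulateCount_succ (n h d : ℕ) : accumulateCount (n + 1) h d =
    #{x : Fin n → ZMod 2 | hammingNorm x = h ∧
      hammingNorm (accumulate x) + (if (h : ZMod 2) ≠ 0 then 1 else 0) = d} +
    #{x : Fin n → ZMod 2 | hammingNorm x + 1 = h ∧
      hammingNorm (accumulate x) + (if (h : ZMod 2) ≠ 0 then 1 else 0) = d} := by
  rw [accumulateCount, card_filter, ← (Fin.snocEquiv fun _ => ZMod 2).sum_comp,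
    Fintype.sum_prod_type]
  have h2 : ∀ f : ZMod 2 → ℕ, ∑ b, f b = f 0 + f 1 := fun f => Fin.sum_univ_two f
  rw [h2, card_filter, card_filter]
  have he : ∀ (b : ZMod 2) (x : Fin n → ZMod 2),
      Fin.snocEquiv (fun _ => ZMod 2) (b, x) = (Fin.snoc x b : Fin (n + 1) → ZMod 2) :=
    fun _ _ => rfl
  simp only [he, hammingNorm_snoc, hammingNorm_accumulate_snoc]
  congr 1
  · refine sum_congr rfl fun x _ => ?_
    refine if_congr ?_ rfl rfl
    simp only [ne_eq, not_true_eq_false, if_false, add_zero]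
    exact and_congr_right fun hx => by rw [hx]
  · refine sum_congr rfl fun x _ => ?_
    refine if_congr ?_ rfl rfl
    simp only [ne_eq, one_ne_zero, not_false_eq_true, if_true]
    exact and_congr_right fun hx => by rw [← hx]; push_cast; rfl

/-- The `⌈h / 2⌉` ones of the input that switch the output on lie in the support of the output, and
the `⌊h / 2⌋` that switch it off lie outside; these positions determine the input. The proof is by
Pascal's rule and induction on the length. -/
theorem accumulateCount_le (n h d : ℕ) :
    accumulateCount n h d ≤ d.choose ((h + 1) / 2) * (n - d).choose (h / 2) := by
  induction n generalizing h d with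
  | zero =>
    have hN : ∀ x : Fin 0 → ZMod 2, hammingNorm x = 0 := fun x => by
      rw [hammingNorm_eq_sum, Fin.sum_univ_zero]
    rcases Nat.eq_zero_or_pos d with rfl | hd
    · rcases Nat.eq_zero_or_pos h with rfl | hh
      · refine (card_le_univ _).trans ?_
        simp
      · rw [accumulateCount, card_eq_zero.2]
        · exact Nat.zero_le _
        · rw [filter_eq_empty_iff]
          rintro x - ⟨h1, -⟩
          rw [hN] at h1
          omega
    · rw [accumulateCount_eq_zero h hd]
      exact Nat.zero_le _
  | succ n ih =>
    rcases lt_or_ge (n + 1) d with hd | hd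
    · rw [accumulateCount_eq_zero h hd]
      exact Nat.zero_le _
    rw [accumulateCount_succ]
    obtain ⟨k, rfl | rfl⟩ := Nat.even_or_odd' h
    · have h0 : ((2 * k : ℕ) : ZMod 2) = 0 := by
        push_cast
        rw [show (2 : ZMod 2) = 0 from rfl, zero_mul]
      simp only [h0, ne_eq, not_true_eq_false, if_false, add_zero]
      rcases hd.eq_or_lt with rfl | hd
      · have h1 := accumulateCount_eq_zero (2 * k) (Nat.lt_succ_self n)
        have h2 : #{x : Fin n → ZMod 2 | hammingNorm x + 1 = 2 * k ∧
            hammingNorm (accumulate x) = n + 1} = 0 := by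
          rw [← Nat.le_zero, ← accumulateCount_eq_zero (2 * k - 1) (Nat.lt_succ_self n)]
          refine card_le_card fun x => ?_
          simp only [mem_filter, mem_univ, true_and]
          rintro ⟨a, b⟩
          exact ⟨by omega, b⟩
        rw [accumulateCount] at h1
        simp only [Nat.succ_eq_add_one] at h1
        rw [h1, h2]
        exact Nat.zero_le _
      · have hd' : d ≤ n := Nat.lt_succ_iff.1 hd
        rcases k with _ | k
        · have := ih 0 d
          rw [accumulateCount] at this
          simp at this ⊢
          exact this
        · have i1 := ih (2 * k + 2) d
          have i2 := ih (2 * k + 1) d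
          rw [show (2 * k + 2 + 1) / 2 = k + 1 by omega, show (2 * k + 2) / 2 = k + 1 by omega]
            at i1
          rw [show (2 * k + 1 + 1) / 2 = k + 1 by omega, show (2 * k + 1) / 2 = k by omega] at i2
          rw [accumulateCount] at i1 i2
          rw [show (2 * (k + 1) + 1) / 2 = k + 1 by omega, show 2 * (k + 1) / 2 = k + 1 by omega,
            show n + 1 - d = n - d + 1 by omega, Nat.choose_succ_succ]
          simp only [show ∀ a, (a + 1 = 2 * (k + 1)) = (a = 2 * k + 1) from
            fun a => propext (by omega)]
          rw [show 2 * (k + 1) = 2 * k + 2 by ring]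
          linarith
    · have h0 : ((2 * k + 1 : ℕ) : ZMod 2) = 1 := by
        push_cast
        rw [show (2 : ZMod 2) = 0 from rfl, zero_mul, zero_add]
      simp only [h0, ne_eq, one_ne_zero, not_false_eq_true, if_true]
      rcases d with _ | e
      · simp
      · have i1 := ih (2 * k + 1) e
        have i2 := ih (2 * k) e
        rw [show (2 * k + 1 + 1) / 2 = k + 1 by omega, show (2 * k + 1) / 2 = k by omega] at i1
        rw [show (2 * k + 1) / 2 = k by omega, show (2 * k) / 2 = k by omega] at i2
        rw [accumulateCount] at i1 i2
        rw [show (2 * k + 1 + 1) / 2 = k + 1 by omega, show (2 * k + 1) / 2 = k by omega,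
          show n + 1 - (e + 1) = n - e by omega, Nat.choose_succ_succ]
        simp only [add_left_inj]
        linarith

theorem card_hammingNorm_eq (n m : ℕ) :
    #{x : Fin n → ZMod 2 | hammingNorm x = m} = n.choose m := by
  have : #(powersetCard m (univ : Finset (Fin n))) = n.choose m := by
    rw [card_powersetCard, card_univ, Fintype.card_fin]
  rw [← this]
  refine card_nbij' (fun x => univ.filter fun i => x i ≠ 0) (fun s i => if i ∈ s then 1 else 0)
    ?_ ?_ ?_ ?_
  · intro x hx
    simpa [mem_powersetCard, hammingNorm] using hx
  · intro s hs
    simpa [mem_powersetCard, hammingNorm] using hs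
  · intro x _
    ext i
    simp only [mem_filter, mem_univ, true_and]
    generalize x i = a
    revert a
    decide
  · intro s _
    ext i
    simp

theorem hammingNorm_comp_perm {ι : Type*} [Fintype ι] (x : ι → ZMod 2) (σ : Equiv.Perm ι) :
    hammingNorm (x ∘ σ) = hammingNorm x := by
  rw [hammingNorm_eq_sum, hammingNorm_eq_sum]
  exact Equiv.sum_comp σ fun i => if x i ≠ 0 then 1 else 0

theorem card_perm_comp_eq_le {N : ℕ} (x y : Fin N → ZMod 2) :
    #{σ : Equiv.Perm (Fin N) | x ∘ σ = y}
      ≤ (hammingNorm x).factorial * (N - hammingNorm x).factorial := by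
  have hstab : #{σ : Equiv.Perm (Fin N) | x ∘ σ = x}
      = (hammingNorm x).factorial * (N - hammingNorm x).factorial := by
    have := DomMulAct.stabilizer_card (f := x)
    rw [Fintype.card_subtype] at this
    have h2 : ∀ f : ZMod 2 → ℕ, ∏ b, f b = f 0 * f 1 := fun f => Fin.prod_univ_two f
    rw [this, h2, Fintype.card_subtype, Fintype.card_subtype]
    have e1 : #{a | x a = 1} = hammingNorm x := by
      rw [hammingNorm]
      congr 1
      ext a
      simp only [mem_filter, mem_univ, true_and]
      generalize x a = b
      revert b
      decide
    have e2 : #{a | x a = 0} + hammingNorm x = N := by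
      rw [hammingNorm, card_filter_add_card_filter_not, card_univ, Fintype.card_fin]
    rw [e1, show #{a | x a = 0} = N - hammingNorm x by omega, mul_comm]
  rw [← hstab]
  rcases ({σ : Equiv.Perm (Fin N) | x ∘ σ = y} : Finset _).eq_empty_or_nonempty with h | ⟨τ, hτ⟩
  · rw [h]
    simp
  · simp only [mem_filter, mem_univ, true_and] at hτ
    refine card_le_card_of_injOn (fun σ => σ * τ⁻¹) ?_ ?_
    · intro σ hσ
      simp only [coe_filter, mem_univ, true_and, Set.mem_ofPred_eq] at hσ ⊢
      ext i
      have := congrFun (hσ.trans hτ.symm) (τ⁻¹ i)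
      simpa using this
    · intro σ _ σ' _ h
      simpa using h

/-- A uniformly random interleaver maps `x` to a uniformly random word of the same weight. -/
theorem card_perm_filter_mul_choose_le {N : ℕ} (x : Fin N → ZMod 2)
    (Q : (Fin N → ZMod 2) → Prop) [DecidablePred Q] :
    #{σ : Equiv.Perm (Fin N) | Q (x ∘ σ)} * N.choose (hammingNorm x)
      ≤ N.factorial * #{y : Fin N → ZMod 2 | hammingNorm y = hammingNorm x ∧ Q y} := by
  have hle : hammingNorm x ≤ N := by
    simpa using hammingNorm_le_card_fintype (x := x)
  have h1 : #{σ : Equiv.Perm (Fin N) | Q (x ∘ σ)}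
      ≤ #{y : Fin N → ZMod 2 | hammingNorm y = hammingNorm x ∧ Q y}
        * ((hammingNorm x).factorial * (N - hammingNorm x).factorial) := by
    rw [card_eq_sum_card_fiberwise (f := fun σ : Equiv.Perm (Fin N) => x ∘ σ)
      (t := {y : Fin N → ZMod 2 | hammingNorm y = hammingNorm x ∧ Q y})]
    · rw [← smul_eq_mul]
      refine sum_le_card_nsmul _ _ _ fun y _ => ?_
      refine (card_le_card ?_).trans (card_perm_comp_eq_le x y)
      intro σ
      simp only [mem_filter, mem_univ, true_and]
      exact fun h => h.2
    · intro σ hσ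
      simp only [coe_filter, mem_univ, true_and, Set.mem_ofPred_eq] at hσ ⊢
      exact ⟨hammingNorm_comp_perm x σ, hσ⟩
  calc _ ≤ _ := Nat.mul_le_mul_right _ h1
    _ = N.factorial * _ := by
      rw [← Nat.choose_mul_factorial_mul_factorial hle]
      ring

theorem hammingNorm_repetitionEncode (q K : ℕ) (u : Fin K → ZMod 2) :
    hammingNorm (repetitionEncode q K u) = hammingNorm u * q := by
  rw [hammingNorm_eq_sum, ← finProdFinEquiv.sum_comp, Fintype.sum_prod_type, hammingNorm_eq_sum,
    sum_mul]
  refine sum_congr rfl fun a _ => ?_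
  have : ∀ b : Fin q, repetitionEncode q K u (finProdFinEquiv (a, b)) = u a := by
    intro b
    have := finProdFinEquiv.symm_apply_apply (a, b)
    rw [finProdFinEquiv_symm_apply] at this
    exact congrArg u (congrArg Prod.fst this)
  simp [this, mul_comm]

theorem raaEncode_sub (q K : ℕ) (π : Interleavers q K) (u v : Fin K → ZMod 2) :
    raaEncode q K π (u - v) = raaEncode q K π u - raaEncode q K π v := by
  unfold raaEncode
  rw [← accumulate_sub]
  congr 1
  rw [show repetitionEncode q K (u - v) ∘ π.1
    = repetitionEncode q K u ∘ π.1 - repetitionEncode q K v ∘ π.1 from rfl, accumulate_sub]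
  rfl

theorem raaEncode_injective {q : ℕ} (hq : 0 < q) (K : ℕ) (π : Interleavers q K) :
    Function.Injective (raaEncode q K π) := by
  intro u v h
  have h1 := π.2.surjective.injective_comp_right (accumulate_injective h)
  have h2 := π.1.surjective.injective_comp_right (accumulate_injective h1)
  ext a
  have := congrFun h2 (finProdFinEquiv (a, ⟨0, hq⟩))
  have e := finProdFinEquiv.symm_apply_apply (a, (⟨0, hq⟩ : Fin q))
  rw [finProdFinEquiv_symm_apply] at e
  have e1 : (finProdFinEquiv (a, (⟨0, hq⟩ : Fin q))).divNat = a := congrArg Prod.fst e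
  simpa only [repetitionEncode, e1] using this

theorem exists_hammingNorm_le_of_minDistance_le {q K : ℕ} (hq : 0 < q) (hK : 0 < K)
    (π : Interleavers q K) {D : ℝ} (h : (minDistance (raaCode q K π) : ℝ) ≤ D) :
    ∃ u : Fin K → ZMod 2, u ≠ 0 ∧ (hammingNorm (raaEncode q K π u) : ℝ) ≤ D := by
  have hne : {d : ℕ | ∃ x ∈ raaCode q K π, ∃ y ∈ raaCode q K π,
      x ≠ y ∧ hammingDist x y = d}.Nonempty := by
    refine ⟨_, raaEncode q K π (fun _ => 1), ⟨_, rfl⟩, raaEncode q K π 0, ⟨_, rfl⟩, ?_, rfl⟩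
    intro h
    have := congrFun (raaEncode_injective hq K π h) ⟨0, hK⟩
    simp at this
  obtain ⟨_, ⟨u, rfl⟩, _, ⟨v, rfl⟩, huv, hd⟩ := Nat.sInf_mem hne
  refine ⟨u - v, sub_ne_zero.2 fun e => huv (by rw [e]), ?_⟩
  have hdist : hammingNorm (raaEncode q K π u - raaEncode q K π v)
      = hammingDist (raaEncode q K π u) (raaEncode q K π v) := by
    simp only [hammingNorm, hammingDist, Pi.sub_apply, sub_ne_zero]
  rw [raaEncode_sub, hdist, hd]
  exact h

end

/-! ### The union bound -/

section

open Finset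

/-- The probability that a random word of length `N` and weight `h` accumulates to a word of
weight `d`. For `N < h` there is no such word, and the value is `0 / 0 = 0`. -/
noncomputable def accumulateProb (N h d : ℕ) : ℝ := accumulateCount N h d / N.choose h

/-- The probability that a random word of length `N` and weight `h` accumulates to a word of weight
at most `D`. -/
noncomputable def accumulateTail (N h : ℕ) (D : ℝ) : ℝ :=
  ∑ d ∈ (range (N + 1)).filter fun d : ℕ => (d : ℝ) ≤ D, accumulateProb N h d

theorem accumulateProb_nonneg (N h d : ℕ) : 0 ≤ accumulateProb N h d := by
  unfold accumulateProb; positivity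

theorem accumulateTail_nonneg (N h : ℕ) (D : ℝ) : 0 ≤ accumulateTail N h D :=
  sum_nonneg fun _ _ => accumulateProb_nonneg _ _ _

theorem hammingNorm_le {N : ℕ} (x : Fin N → ZMod 2) : hammingNorm x ≤ N := by
  simpa using hammingNorm_le_card_fintype (x := x)

theorem sum_accumulateCount (N h : ℕ) (p : ℕ → Prop) [DecidablePred p] :
    ∑ d ∈ range (N + 1) with p d, accumulateCount N h d
      = #{y : Fin N → ZMod 2 | hammingNorm y = h ∧ p (hammingNorm (accumulate y))} := by
  rw [card_eq_sum_card_fiberwise (f := fun y => hammingNorm (accumulate y))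
    (t := (range (N + 1)).filter p)]
  · refine sum_congr rfl fun d hd => ?_
    rw [accumulateCount]
    congr 1
    ext y
    simp only [mem_filter, mem_univ, true_and, mem_range] at hd ⊢
    constructor
    · rintro ⟨h1, rfl⟩; exact ⟨⟨h1, hd.2⟩, rfl⟩
    · rintro ⟨⟨h1, h2⟩, h3⟩; exact ⟨h1, h3⟩
  · intro y hy
    simp only [coe_filter, mem_univ, true_and, Set.mem_ofPred_eq, mem_range] at hy ⊢
    exact ⟨Nat.lt_succ_of_le (hammingNorm_le _), hy.2⟩

theorem accumulateTail_eq (N h : ℕ) (D : ℝ) : accumulateTail N h D =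
    #{y : Fin N → ZMod 2 | hammingNorm y = h ∧ (hammingNorm (accumulate y) : ℝ) ≤ D}
      / N.choose h := by
  rw [← sum_accumulateCount N h fun d => (d : ℝ) ≤ D, Nat.cast_sum, sum_div]
  rfl

theorem accumulateTail_le_one (N h : ℕ) (D : ℝ) : accumulateTail N h D ≤ 1 := by
  rw [accumulateTail_eq]
  refine div_le_one_of_le₀ ?_ (Nat.cast_nonneg _)
  rw [← card_hammingNorm_eq]
  exact_mod_cast card_le_card fun y => by
    simp only [mem_filter, mem_univ, true_and]
    exact fun h => h.1

theorem card_perm_filter_le {N : ℕ} (x : Fin N → ZMod 2)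
    (Q : (Fin N → ZMod 2) → Prop) [DecidablePred Q] :
    (#{σ : Equiv.Perm (Fin N) | Q (x ∘ σ)} : ℝ) ≤ N.factorial *
      (#{y : Fin N → ZMod 2 | hammingNorm y = hammingNorm x ∧ Q y}
        / N.choose (hammingNorm x)) := by
  have h0 : (0 : ℝ) < N.choose (hammingNorm x) := by
    exact_mod_cast Nat.choose_pos (hammingNorm_le x)
  rw [← mul_div_assoc, le_div_iff₀ h0]
  exact_mod_cast card_perm_filter_mul_choose_le x Q

theorem card_perm_accumulate_le_tail {N : ℕ} (x : Fin N → ZMod 2) (D : ℝ) :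
    (#{σ : Equiv.Perm (Fin N) | (hammingNorm (accumulate (x ∘ σ)) : ℝ) ≤ D} : ℝ)
      ≤ N.factorial * accumulateTail N (hammingNorm x) D := by
  rw [accumulateTail_eq]
  exact card_perm_filter_le x fun y => (hammingNorm (accumulate y) : ℝ) ≤ D

/-- The law of the output weight is the composition of the laws of the two stages. -/
theorem card_perm_pairs_le {N : ℕ} (x : Fin N → ZMod 2) (D : ℝ) :
    (#{π : Equiv.Perm (Fin N) × Equiv.Perm (Fin N) |
        (hammingNorm (accumulate (accumulate (x ∘ π.1) ∘ π.2)) : ℝ) ≤ D} : ℝ)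
      ≤ (N.factorial : ℝ) ^ 2 * ∑ h ∈ range (N + 1),
        accumulateProb N (hammingNorm x) h * accumulateTail N h D := by
  have h1 : (#{π : Equiv.Perm (Fin N) × Equiv.Perm (Fin N) |
        (hammingNorm (accumulate (accumulate (x ∘ π.1) ∘ π.2)) : ℝ) ≤ D} : ℝ)
      = ∑ σ : Equiv.Perm (Fin N), (#{τ : Equiv.Perm (Fin N) |
        (hammingNorm (accumulate (accumulate (x ∘ σ) ∘ τ)) : ℝ) ≤ D} : ℝ) := by
    simp only [card_filter]
    rw [Fintype.sum_prod_type]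
    push_cast
    rfl
  have h2 : ∑ σ : Equiv.Perm (Fin N), accumulateTail N (hammingNorm (accumulate (x ∘ σ))) D
      = ∑ h ∈ range (N + 1), (#{σ : Equiv.Perm (Fin N) |
        hammingNorm (accumulate (x ∘ σ)) = h} : ℝ) * accumulateTail N h D := by
    rw [← sum_fiberwise_of_maps_to (t := range (N + 1))
      (g := fun σ : Equiv.Perm (Fin N) => hammingNorm (accumulate (x ∘ σ)))
      fun σ _ => mem_range.2 (Nat.lt_succ_of_le (hammingNorm_le _))]
    refine sum_congr rfl fun h _ => ?_
    rw [← nsmul_eq_mul, ← sum_const]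
    refine sum_congr rfl fun σ hσ => ?_
    rw [(mem_filter.1 hσ).2]
  calc _ ≤ ∑ σ : Equiv.Perm (Fin N), (N.factorial : ℝ) *
        accumulateTail N (hammingNorm (accumulate (x ∘ σ))) D := by
        rw [h1]
        exact sum_le_sum fun σ _ => card_perm_accumulate_le_tail _ D
    _ = N.factorial * ∑ h ∈ range (N + 1), (#{σ : Equiv.Perm (Fin N) |
        hammingNorm (accumulate (x ∘ σ)) = h} : ℝ) * accumulateTail N h D := by
        rw [← mul_sum, h2]
    _ ≤ N.factorial * ∑ h ∈ range (N + 1),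
        (N.factorial * accumulateProb N (hammingNorm x) h) * accumulateTail N h D := by
        gcongr with h _
        · exact accumulateTail_nonneg _ _ _
        · exact card_perm_filter_le x fun y => hammingNorm (accumulate y) = h
    _ = _ := by
        simp only [mul_assoc]
        rw [← mul_sum]
        ring

/-- The union bound over the nonzero information words, grouped by their weight `w`; the
intermediate word has weight `h`. -/
theorem one_sub_raaFraction_le {q K : ℕ} (hq : 0 < q) (hK : 0 < K) (ρ : ℝ) :
    1 - raaFraction q K ρ ≤ ∑ w ∈ Icc 1 K, (K.choose w : ℝ) *
      ∑ h ∈ range (K * q + 1), accumulateProb (K * q) (w * q) h *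
        accumulateTail (K * q) h (ρ * (K * q : ℕ)) := by
  classical
  set N := K * q with hN
  set D : ℝ := ρ * (N : ℕ) with hD
  set B : ℕ → ℝ := fun w => ∑ h ∈ range (N + 1), accumulateProb N (w * q) h *
    accumulateTail N h D with hB
  have hB0 : ∀ w, 0 ≤ B w := fun w => sum_nonneg fun h _ =>
    mul_nonneg (accumulateProb_nonneg _ _ _) (accumulateTail_nonneg _ _ _)
  have hcard : (Nat.card (Interleavers q K) : ℝ) = (N.factorial : ℝ) ^ 2 := by
    rw [Nat.card_prod, Nat.card_eq_fintype_card, Fintype.card_perm, Fintype.card_fin]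
    push_cast
    ring
  have hpos : (0 : ℝ) < (N.factorial : ℝ) ^ 2 := by positivity
  have hsplit : (Nat.card {π : Interleavers q K // D < (minDistance (raaCode q K π) : ℝ)} : ℝ)
      + (#{π : Interleavers q K | ¬ D < (minDistance (raaCode q K π) : ℝ)} : ℝ)
      = (N.factorial : ℝ) ^ 2 := by
    rw [← hcard, Nat.card_eq_fintype_card, Fintype.card_subtype, Nat.card_eq_fintype_card]
    exact_mod_cast card_filter_add_card_filter_not _
  have hbad : (#{π : Interleavers q K | ¬ D < (minDistance (raaCode q K π) : ℝ)} : ℝ)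
      ≤ ∑ u ∈ (univ : Finset (Fin K → ZMod 2)) with u ≠ 0,
        (#{π : Interleavers q K | (hammingNorm (raaEncode q K π u) : ℝ) ≤ D} : ℝ) := by
    have : ({π : Interleavers q K | ¬ D < (minDistance (raaCode q K π) : ℝ)} : Finset _)
        ⊆ ((univ : Finset (Fin K → ZMod 2)).filter fun u => u ≠ 0).biUnion fun u =>
          {π : Interleavers q K | (hammingNorm (raaEncode q K π u) : ℝ) ≤ D} := by
      intro π hπ
      simp only [mem_filter, mem_univ, true_and, mem_biUnion, not_lt] at hπ ⊢
      exact exists_hammingNorm_le_of_minDistance_le hq hK π hπ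
    exact_mod_cast (card_le_card this).trans card_biUnion_le
  have hu : ∀ u : Fin K → ZMod 2,
      (#{π : Interleavers q K | (hammingNorm (raaEncode q K π u) : ℝ) ≤ D} : ℝ)
        ≤ (N.factorial : ℝ) ^ 2 * B (hammingNorm u) := by
    intro u
    have := card_perm_pairs_le (repetitionEncode q K u) D
    rw [hammingNorm_repetitionEncode] at this
    exact this
  have hw : ∑ u ∈ (univ : Finset (Fin K → ZMod 2)) with u ≠ 0, B (hammingNorm u)
      = ∑ w ∈ Icc 1 K, (K.choose w : ℝ) * B w := by
    rw [← sum_fiberwise_of_maps_to (t := Icc 1 K) (g := fun u : Fin K → ZMod 2 => hammingNorm u)]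
    · refine sum_congr rfl fun w hw => ?_
      rw [← card_hammingNorm_eq, ← nsmul_eq_mul, ← sum_const]
      refine sum_congr ?_ fun u hu => ?_
      · ext u
        simp only [mem_filter, mem_univ, true_and, and_iff_right_iff_imp]
        rintro rfl
        exact hammingNorm_ne_zero_iff.1 (by have := (mem_Icc.1 hw).1; omega)
      · rw [(mem_filter.1 hu).2]
    · intro u hu
      exact mem_Icc.2 ⟨hammingNorm_pos_iff.2 (mem_filter.1 hu).2, hammingNorm_le u⟩
  have htot : (#{π : Interleavers q K | ¬ D < (minDistance (raaCode q K π) : ℝ)} : ℝ)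
      ≤ (N.factorial : ℝ) ^ 2 * ∑ w ∈ Icc 1 K, (K.choose w : ℝ) * B w := by
    rw [← hw, mul_sum]
    exact hbad.trans (sum_le_sum fun u _ => hu u)
  rw [raaFraction, hcard, one_sub_div hpos.ne', div_le_iff₀ hpos]
  linarith

end

/-! ### Small intermediate weights -/

section

open Real Finset

theorem choose_mul_pow_le {N m b : ℕ} (j : ℕ) (h : b + j ≤ m) :
    N.choose b * (N - m) ^ j ≤ N.choose (b + j) * m ^ j := by
  induction j with
  | zero => simp
  | succ j ih =>
    have h1 := Nat.choose_succ_right_eq N (b + j)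
    calc N.choose b * (N - m) ^ (j + 1) = N.choose b * (N - m) ^ j * (N - m) := by ring
      _ ≤ N.choose (b + j) * m ^ j * (N - (b + j)) := by
        refine Nat.mul_le_mul (ih (by omega)) (by omega)
      _ = N.choose (b + j + 1) * (b + j + 1) * m ^ j := by rw [h1]; ring
      _ ≤ N.choose (b + j + 1) * m * m ^ j := by
        gcongr
        omega
      _ = N.choose (b + (j + 1)) * m ^ (j + 1) := by rw [← add_assoc]; ring

theorem accumulateProb_eq_zero {N m h : ℕ} (hm : h < (m + 1) / 2) : accumulateProb N m h = 0 := by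
  have := accumulateCount_le N m h
  rw [Nat.choose_eq_zero_of_lt hm, zero_mul, Nat.le_zero] at this
  simp [accumulateProb, this]

theorem accumulateProb_le_pow {N m h : ℕ} (h0 : 0 < h) (hN : 4 * h ≤ N) :
    accumulateProb N m h ≤ (4 * (h : ℝ) ^ 2 / N) ^ ((m + 1) / 2) := by
  rcases lt_or_ge h ((m + 1) / 2) with hlt | hge
  · rw [accumulateProb_eq_zero hlt]; positivity
  set a := (m + 1) / 2 with ha
  have hm : m / 2 + a = m := by omega
  have hm2 : m ≤ 2 * h := by omega
  have hmN : m ≤ N := by omega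
  have hNpos : (0 : ℝ) < N := by
    have : 0 < N := by omega
    exact_mod_cast this
  have hC : (0 : ℝ) < N.choose m := by exact_mod_cast Nat.choose_pos hmN
  have h1 : (accumulateCount N m h : ℝ) ≤ (h : ℝ) ^ a * N.choose (m / 2) := by
    refine (Nat.cast_le.2 (accumulateCount_le N m h)).trans ?_
    push_cast
    gcongr
    · exact_mod_cast Nat.choose_le_pow h a
    · omega
  have h2 : (N.choose (m / 2) : ℝ) * ((N : ℝ) / 2) ^ a ≤ N.choose m * (2 * h : ℝ) ^ a := by
    have := choose_mul_pow_le (N := N) a hm.le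
    rw [hm] at this
    have h3 : (N.choose (m / 2) : ℝ) * ((N : ℝ) - m) ^ a ≤ N.choose m * (m : ℝ) ^ a := by
      rw [← Nat.cast_sub hmN]
      exact_mod_cast this
    have h4 : (m : ℝ) ≤ 2 * h := by exact_mod_cast hm2
    have h5 : 4 * (h : ℝ) ≤ N := by exact_mod_cast hN
    refine le_trans ?_ (h3.trans ?_)
    · gcongr
      linarith
    · gcongr
  rw [accumulateProb, div_le_iff₀ hC]
  refine h1.trans ?_
  have e : (4 * (h : ℝ) ^ 2 / N) ^ a * N.choose m * ((N : ℝ) / 2) ^ a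
      = (h : ℝ) ^ a * (N.choose m * (2 * h : ℝ) ^ a) := by
    rw [mul_right_comm, ← mul_pow, mul_left_comm, ← mul_pow, mul_comm]
    congr 2
    field_simp
    ring
  refine le_of_mul_le_mul_right ?_ (show (0 : ℝ) < ((N : ℝ) / 2) ^ a by positivity)
  rw [e, mul_assoc]
  gcongr

/-- For intermediate weights `h` that are small compared with the length, the expected number of
information words of weight `w` with intermediate weight `h` is small. A word of weight `w * q`
needs `⌈w * q / 2⌉ ≥ 3 * w / 2` of its ones within `h` positions, each at a cost of order
`h ^ 2 / N`, while there are at most `N ^ w` words. -/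
theorem choose_mul_accumulateProb_le {q K w h : ℕ} (hq : 3 ≤ q) (hw : 1 ≤ w)
    (hh : 8 * (h : ℝ) ^ 3 ≤ √((K * q : ℕ) : ℝ)) :
    (K.choose w : ℝ) * accumulateProb (K * q) (w * q) h ≤ 8 * (h : ℝ) ^ 3 / √((K * q : ℕ) : ℝ) := by
  set N := K * q with hN
  have hwq : 3 * w ≤ w * q := by nlinarith
  rcases Nat.eq_zero_or_pos h with rfl | h0
  · rw [accumulateProb_eq_zero (by omega)]; simp
  have h0' : (1 : ℝ) ≤ h := by exact_mod_cast h0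
  have hh3 : (h : ℝ) ≤ (h : ℝ) ^ 3 := le_self_pow₀ h0' (by norm_num)
  have hs : (0 : ℝ) < √(N : ℝ) := by linarith
  have hNpos : (0 : ℝ) < N := sqrt_pos.1 hs
  have hsq : √(N : ℝ) ^ 2 = N := sq_sqrt hNpos.le
  have h4 : 4 * h ≤ N := by
    have : 4 * (h : ℝ) ≤ N := by rw [← hsq]; nlinarith
    exact_mod_cast this
  have hx1 : 2 * (h : ℝ) / √(N : ℝ) ≤ 1 := by rw [div_le_one hs]; linarith
  have hP : accumulateProb N (w * q) h ≤ (2 * (h : ℝ) / √(N : ℝ)) ^ (3 * w) := by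
    refine (accumulateProb_le_pow h0 h4).trans ?_
    have : 4 * (h : ℝ) ^ 2 / N = (2 * (h : ℝ) / √(N : ℝ)) ^ 2 := by
      rw [div_pow, hsq]; ring
    rw [this, ← pow_mul]
    exact pow_le_pow_of_le_one (by positivity) hx1 (by omega)
  have hC : (K.choose w : ℝ) ≤ (N : ℝ) ^ w := by
    have h1 : K.choose w ≤ N ^ w :=
      (Nat.choose_le_pow K w).trans (Nat.pow_le_pow_left (Nat.le_mul_of_pos_right K (by omega)) w)
    exact_mod_cast h1
  calc (K.choose w : ℝ) * accumulateProb N (w * q) h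
      ≤ (N : ℝ) ^ w * (2 * (h : ℝ) / √(N : ℝ)) ^ (3 * w) := by
        gcongr
        exact accumulateProb_nonneg _ _ _
    _ = (8 * (h : ℝ) ^ 3 / √(N : ℝ)) ^ w := by
        rw [pow_mul, ← mul_pow]
        congr 1
        nth_rewrite 1 [← hsq]
        field_simp
        norm_num
    _ ≤ 8 * (h : ℝ) ^ 3 / √(N : ℝ) :=
        pow_le_of_le_one (by positivity) ((div_le_one hs).2 hh) (by omega)

end

/-! ### Entropy estimates -/

section

open Real Finset

theorem log_factorial_ge (n : ℕ) : -negMulLog n - n ≤ log n.factorial := by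
  induction n with
  | zero => simp
  | succ n ih =>
    have h1 := mul_log_div_le (b := n) (t := n + 1) (by positivity) (by positivity)
    rw [Nat.factorial_succ, Nat.cast_mul, log_mul (by positivity) (by positivity)]
    push_cast
    simp only [negMulLog] at *
    linarith

theorem log_factorial_le (n : ℕ) : log n.factorial ≤ -negMulLog n - n + (1 + log n) := by
  induction n with
  | zero => simp
  | succ n ih =>
    rw [Nat.factorial_succ, Nat.cast_mul, log_mul (by positivity) (by positivity)]
    rcases Nat.eq_zero_or_pos n with rfl | hn
    · simp
    have hn' : (0 : ℝ) < n := by exact_mod_cast hn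
    have h1 := mul_log_div_le (b := (n : ℝ) + 1) (t := n) (by positivity) hn'
    push_cast
    simp only [negMulLog] at *
    linarith

/-- The entropy estimate of binomial coefficients, with an error uniform in `n ≤ N`. -/
theorem abs_log_choose_sub_le {N n k : ℕ} (hN : 1 ≤ N) (hn : n ≤ N) (hk : k ≤ n) :
    |log (n.choose k) - (negMulLog k + negMulLog ((n : ℝ) - k) - negMulLog n)|
      ≤ 2 * (1 + log N) := by
  have hl : ∀ j : ℕ, j ≤ N → log j ≤ log N := by
    intro j hj
    rcases Nat.eq_zero_or_pos j with rfl | hj0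
    · simpa using log_nonneg (by exact_mod_cast hN)
    · exact log_le_log (by exact_mod_cast hj0) (by exact_mod_cast hj)
  have hN0 : 0 ≤ log N := log_nonneg (by exact_mod_cast hN)
  have e : log n.factorial = log (n.choose k) + log k.factorial + log (n - k).factorial := by
    rw [← Nat.choose_mul_factorial_mul_factorial hk]
    have := Nat.choose_pos hk
    push_cast
    rw [log_mul (by positivity) (by positivity), log_mul (by positivity) (by positivity)]
  have a1 := log_factorial_ge n
  have a2 := log_factorial_le n
  have b1 := log_factorial_ge k
  have b2 := log_factorial_le k
  have c1 := log_factorial_ge (n - k)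
  have c2 := log_factorial_le (n - k)
  have d1 := hl n hn
  have d2 := hl k (hk.trans hn)
  have d3 := hl (n - k) ((Nat.sub_le _ _).trans hn)
  rw [Nat.cast_sub hk] at c1 c2 d3
  rw [abs_le]
  constructor <;> linarith

/-- Rounding the argument changes `Real.negMulLog` by a logarithmic term only; this absorbs the
parities of the weights. -/
theorem abs_negMulLog_sub_le {N x y : ℝ} (hN : 1 ≤ N) (hx : 0 ≤ x) (hy : 0 ≤ y) (hxN : x ≤ N)
    (hyN : y ≤ N) (hxy : |x - y| ≤ 1) : |negMulLog x - negMulLog y| ≤ 1 + log N := by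
  wlog hle : x ≤ y generalizing x y
  · rw [abs_sub_comm]
    exact this hy hx hyN hxN (by rwa [abs_sub_comm]) (not_le.1 hle).le
  rw [abs_le] at hxy
  have hN0 : 0 ≤ log N := log_nonneg hN
  rcases hle.eq_or_lt with rfl | hlt
  · simpa using (by linarith : 0 ≤ 1 + log N)
  have hy0 : 0 < y := by linarith
  have hyl : log y ≤ log N := log_le_log hy0 hyN
  have h1 := mul_log_div_le hx hy0
  have h2 : x * log x ≤ x * log y := by
    rcases hx.eq_or_lt with rfl | hx0
    · simp
    · exact mul_le_mul_of_nonneg_left (log_le_log hx0 hle) hx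
  have h3 : (y - x) * log (y - x) ≤ (y - x) * log y :=
    mul_le_mul_of_nonneg_left (log_le_log (by linarith) (by linarith)) (by linarith)
  have h4 := self_sub_one_le_mul_log (x := y - x) (by linarith)
  have h5 : (y - x) * (1 + log y) ≤ 1 + log N := by
    have : (y - x) * (1 + log y) ≤ (y - x) * (1 + log N) :=
      mul_le_mul_of_nonneg_left (by linarith) (by linarith)
    nlinarith
  unfold negMulLog at *
  rw [abs_le]
  constructor
  · linarith
  · linarith

theorem negMulLog_div_mul {N : ℝ} (hN : N ≠ 0) (x : ℝ) :
    N * negMulLog (x / N) = negMulLog x - x / N * negMulLog N := by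
  have := negMulLog_mul (x / N) N
  rw [div_mul_cancel₀ _ hN] at this
  linarith

theorem mul_binEntropy_div {N : ℝ} (hN : N ≠ 0) (x : ℝ) :
    N * binEntropy (x / N) = negMulLog x + negMulLog (N - x) - negMulLog N := by
  rw [mul_comm, binEntropy_div_mul hN]

/-- Homogeneity: `accExponent` in terms of integer weights. -/
theorem mul_accExponent_div {N : ℝ} (hN : N ≠ 0) (x y : ℝ) :
    N * accExponent (x / N) (y / N) = negMulLog (y - x / 2) + negMulLog (N - y - x / 2)
      - negMulLog (N - x) + x * log 2 - negMulLog y - negMulLog (N - y) + negMulLog N := by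
  have e1 : y / N - x / N / 2 = (y - x / 2) / N := by ring
  have e2 : 1 - y / N - x / N / 2 = (N - y - x / 2) / N := by field_simp
  have e3 : 1 - x / N = (N - x) / N := by field_simp
  have e4 : 1 - y / N = (N - y) / N := by field_simp
  have hx : N * (x / N * log 2) = x * log 2 := by field_simp
  unfold accExponent
  rw [e1, e2, e3, e4, mul_sub, mul_sub, mul_add, mul_sub, mul_add, hx, negMulLog_div_mul hN,
    negMulLog_div_mul hN, negMulLog_div_mul hN, negMulLog_div_mul hN, negMulLog_div_mul hN]
  field_simp
  ring

theorem two_mul_negMulLog_half {x : ℝ} (hx : 0 ≤ x) :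
    2 * negMulLog (x / 2) = negMulLog x + x * log 2 := by
  rcases hx.eq_or_lt with rfl | hx
  · simp
  · unfold negMulLog
    rw [log_div hx.ne' two_ne_zero]
    ring

theorem le_of_accumulateProb_pos {N m h : ℕ} (hpos : 0 < accumulateProb N m h) :
    (m + 1) / 2 ≤ h ∧ m / 2 ≤ N - h := by
  by_contra hcon
  have h0 : h.choose ((m + 1) / 2) * (N - h).choose (m / 2) = 0 := by
    rw [mul_eq_zero, Nat.choose_eq_zero_iff, Nat.choose_eq_zero_iff]
    omega
  have := accumulateCount_le N m h
  rw [h0, Nat.le_zero] at this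
  simp [accumulateProb, this] at hpos

theorem log_accumulateProb_le {N m h : ℕ} (hN : 1 ≤ N) (hh : h ≤ N) (hm : m ≤ N)
    (hpos : 0 < accumulateProb N m h) :
    log (accumulateProb N m h) ≤
      negMulLog ((m + 1) / 2 : ℕ) + negMulLog ((h : ℝ) - ((m + 1) / 2 : ℕ)) - negMulLog h
      + negMulLog (m / 2 : ℕ) + negMulLog ((N : ℝ) - h - (m / 2 : ℕ)) - negMulLog ((N : ℝ) - h)
      - negMulLog m - negMulLog ((N : ℝ) - m) + negMulLog N + 6 * (1 + log N) := by
  obtain ⟨h1, h2⟩ := le_of_accumulateProb_pos hpos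
  have a1 := (abs_le.1 (abs_log_choose_sub_le hN hh h1)).2
  have a2 := (abs_le.1 (abs_log_choose_sub_le hN (Nat.sub_le N h) h2)).2
  have a3 := (abs_le.1 (abs_log_choose_sub_le hN le_rfl hm)).1
  have p1 : (0 : ℝ) < h.choose ((m + 1) / 2) := by exact_mod_cast Nat.choose_pos h1
  have p2 : (0 : ℝ) < (N - h).choose (m / 2) := by exact_mod_cast Nat.choose_pos h2
  have p3 : (0 : ℝ) < N.choose m := by exact_mod_cast Nat.choose_pos hm
  rw [Nat.cast_sub hh] at a2
  have : log (accumulateProb N m h) ≤ log (h.choose ((m + 1) / 2)) + log ((N - h).choose (m / 2))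
      - log (N.choose m) := by
    rw [← log_mul p1.ne' p2.ne', ← log_div (by positivity) p3.ne']
    refine log_le_log hpos ?_
    unfold accumulateProb
    gcongr
    exact_mod_cast accumulateCount_le N m h
  linarith

end

/-! ### Asymptotics of the ensemble -/

section

open Real Finset Filter Topology

/-- For the first stage the input weight `m` is rounded down to an even number, because
`m = 2 * (N - h) + 1` would lie just outside the region. -/
theorem log_accumulateProb_le_of_half {N b h : ℕ} (hN : 1 ≤ N) (hb : b ≤ h) (hb' : b + h ≤ N)
    {m : ℕ} (hm : m ≤ N) (hmb : m / 2 = b) (hpos : 0 < accumulateProb N m h) :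
    log (accumulateProb N m h) ≤
      N * accExponent ((2 * b : ℕ) / N) (h / N) + 10 * (1 + log N) := by
  obtain ⟨h1, h2⟩ := le_of_accumulateProb_pos hpos
  have hN' : (1 : ℝ) ≤ N := by exact_mod_cast hN
  have hP := log_accumulateProb_le hN (by omega) hm hpos
  set a := (m + 1) / 2 with ha
  have ab : a = b ∨ a = b + 1 := by omega
  have mb : m = 2 * b ∨ m = 2 * b + 1 := by omega
  have hbh : (b : ℝ) ≤ h := by exact_mod_cast hb
  have hbN : (b : ℝ) + h ≤ N := by exact_mod_cast hb'
  have hah : (a : ℝ) ≤ h := by exact_mod_cast h1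
  have hmN : (m : ℝ) ≤ N := by exact_mod_cast hm
  have hb0 : (0 : ℝ) ≤ b := by positivity
  have ha0 : (0 : ℝ) ≤ a := by positivity
  have hm0 : (0 : ℝ) ≤ m := by positivity
  have hab : |(a : ℝ) - b| ≤ 1 := by
    rcases ab with h | h <;> rw [h] <;> simp
  have hmb' : |(m : ℝ) - 2 * b| ≤ 1 := by
    rcases mb with h | h <;> rw [h] <;> simp
  have e1 := (abs_le.1 (abs_negMulLog_sub_le hN' ha0 hb0 (by linarith) (by linarith) hab)).2
  have e2 := (abs_le.1 (abs_negMulLog_sub_le (x := (h : ℝ) - a) (y := (h : ℝ) - b) hN'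
    (by linarith) (by linarith) (by linarith) (by linarith)
    (by rw [sub_sub_sub_cancel_left, abs_sub_comm]; exact hab))).2
  have e3 := (abs_le.1 (abs_negMulLog_sub_le (x := (m : ℝ)) (y := 2 * b) hN'
    (by linarith) (by linarith) (by linarith) (by linarith) hmb')).1
  have e4 := (abs_le.1 (abs_negMulLog_sub_le (x := (N : ℝ) - m) (y := N - 2 * b) hN'
    (by linarith) (by linarith) (by linarith) (by linarith)
    (by rw [sub_sub_sub_cancel_left, abs_sub_comm]; exact hmb'))).1
  have e5 := two_mul_negMulLog_half (x := 2 * (b : ℝ)) (by linarith)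
  rw [mul_div_cancel_left₀ _ two_ne_zero] at e5
  rw [mul_accExponent_div (by linarith)]
  rw [hmb] at hP
  push_cast
  rw [mul_div_cancel_left₀ _ two_ne_zero]
  linarith

theorem log_accumulateProb_le_accExponent {N h d : ℕ} (hN : 1 ≤ N) (hh : h ≤ N)
    (hd : 2 * d ≤ N) (hpos : 0 < accumulateProb N h d) :
    log (accumulateProb N h d) ≤ N * accExponent (h / N) (d / N) + 10 * (1 + log N) := by
  obtain ⟨h1, -⟩ := le_of_accumulateProb_pos hpos
  have hN' : (1 : ℝ) ≤ N := by exact_mod_cast hN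
  have hP := log_accumulateProb_le hN (by omega) hh hpos
  set a := (h + 1) / 2 with ha
  set b := h / 2 with hb
  have hab : h = a + b := by omega
  have hab1 : a = b ∨ a = b + 1 := by omega
  have hhr : (h : ℝ) = a + b := by exact_mod_cast hab
  have hdr : 2 * (d : ℝ) ≤ N := by exact_mod_cast hd
  have had : (a : ℝ) ≤ d := by exact_mod_cast h1
  have hb0 : (0 : ℝ) ≤ b := by positivity
  have hba : (b : ℝ) ≤ a := by exact_mod_cast (by omega : b ≤ a)
  have hba1 : (a : ℝ) ≤ b + 1 := by exact_mod_cast (by omega : a ≤ b + 1)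
  have key : ∀ x y : ℝ, 0 ≤ x → 0 ≤ y → x ≤ N → y ≤ N → x - y ≤ 1 → y - x ≤ 1 →
      negMulLog x ≤ negMulLog y + (1 + log N) := by
    intro x y hx hy hxN hyN h1 h2
    have := (abs_le.1 (abs_negMulLog_sub_le hN' hx hy hxN hyN
      (abs_le.2 ⟨by linarith, h1⟩))).2
    linarith
  have e1 := key a (h / 2) (by linarith) (by linarith) (by linarith) (by linarith)
    (by linarith) (by linarith)
  have e2 := key b (h / 2) (by linarith) (by linarith) (by linarith) (by linarith)
    (by linarith) (by linarith)
  have e3 := key (d - a) (d - h / 2) (by linarith) (by linarith) (by linarith) (by linarith)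
    (by linarith) (by linarith)
  have e4 := key (N - d - b) (N - d - h / 2) (by linarith) (by linarith) (by linarith)
    (by linarith) (by linarith) (by linarith)
  have e5 := two_mul_negMulLog_half (x := (h : ℝ)) (by linarith)
  rw [mul_accExponent_div (by linarith)]
  linarith

theorem log_choose_le_binEntropy {q K w : ℕ} (hq : 1 ≤ q) (hK : 1 ≤ K) (hw : w ≤ K) :
    log (K.choose w) ≤ (K * q : ℕ) * (binEntropy ((2 * (w * q / 2) : ℕ) / (K * q : ℕ)) / q)
      + 4 * (1 + log (K * q : ℕ)) := by
  set N := K * q with hNdef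
  have hKN : K ≤ N := Nat.le_mul_of_pos_right K hq
  have hN : 1 ≤ N := hK.trans hKN
  have hN' : (1 : ℝ) ≤ N := by exact_mod_cast hN
  have hq' : (1 : ℝ) ≤ q := by exact_mod_cast hq
  have hwN : w * q ≤ N := Nat.mul_le_mul_right q hw
  have hC := (abs_le.1 (abs_log_choose_sub_le hN hKN hw)).2
  set m := w * q with hm
  set b := m / 2 with hb
  have hmN : (m : ℝ) ≤ N := by exact_mod_cast hwN
  have hbm : ((2 * b : ℕ) : ℝ) ≤ m := by exact_mod_cast (by omega : 2 * b ≤ m)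
  have hmb : (m : ℝ) ≤ (2 * b : ℕ) + 1 := by exact_mod_cast (by omega : m ≤ 2 * b + 1)
  have hb0 : (0 : ℝ) ≤ (2 * b : ℕ) := by positivity
  have e3 := (abs_le.1 (abs_negMulLog_sub_le (x := (m : ℝ)) (y := (2 * b : ℕ)) hN'
    (by linarith) (by linarith) (by linarith) (by linarith)
    (abs_le.2 ⟨by linarith, by linarith⟩))).2
  have e4 := (abs_le.1 (abs_negMulLog_sub_le (x := (N : ℝ) - m) (y := N - (2 * b : ℕ)) hN'
    (by linarith) (by linarith) (by linarith) (by linarith)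
    (abs_le.2 ⟨by linarith, by linarith⟩))).2
  have s1 : negMulLog m = q * negMulLog w + w * negMulLog q := by
    rw [hm, Nat.cast_mul, negMulLog_mul]
  have s2 : negMulLog ((N : ℝ) - m) = q * negMulLog ((K : ℝ) - w) + (K - w) * negMulLog q := by
    rw [hm, hNdef, Nat.cast_mul, Nat.cast_mul, ← sub_mul, negMulLog_mul]
  have s3 : negMulLog N = q * negMulLog K + K * negMulLog q := by
    rw [hNdef, Nat.cast_mul, negMulLog_mul]
  have hl : 0 ≤ log N := log_nonneg hN'
  have hmain : q * (negMulLog w + negMulLog ((K : ℝ) - w) - negMulLog K)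
      ≤ N * binEntropy ((2 * b : ℕ) / N) + 2 * (1 + log N) := by
    rw [mul_binEntropy_div (by linarith)]
    linarith
  have hdiv : negMulLog w + negMulLog ((K : ℝ) - w) - negMulLog K
      ≤ (N * binEntropy ((2 * b : ℕ) / N) + 2 * (1 + log N)) / q := by
    rw [le_div_iff₀ (by linarith), mul_comm]
    exact hmain
  have h2 : 2 * (1 + log N) / q ≤ 2 * (1 + log N) := div_le_self (by linarith) hq'
  rw [add_div] at hdiv
  rw [← mul_div_assoc]
  linarith

/-- A summand of the union bound, estimated by the exponent. -/
theorem choose_mul_accumulateProb_mul_le_exp {q K w h d : ℕ} (hq : 1 ≤ q) (hK : 1 ≤ K) (hw : w ≤ K)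
    (h0 : 0 < h)
    {r c : ℝ} (hr : r < 1 / 2)
    (hc : ∀ α β ρ : ℝ, 0 ≤ α → α ≤ 2 * β → α ≤ 2 * (1 - β) → 0 < β → β ≤ 2 * ρ → ρ ≤ r →
      extExponent q α β ρ ≤ -(c * β))
    (hh : h ≤ K * q) (hd : (d : ℝ) ≤ r * (K * q : ℕ)) :
    (K.choose w : ℝ) * (accumulateProb (K * q) (w * q) h * accumulateProb (K * q) h d)
      ≤ exp (24 * (1 + log (K * q : ℕ)) - c * h) := by
  have hC := log_choose_le_binEntropy hq hK hw
  have hwN : w * q ≤ K * q := Nat.mul_le_mul_right q hw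
  set N := K * q with hNdef
  have hKN : K ≤ N := Nat.le_mul_of_pos_right K hq
  have hN : 1 ≤ N := hK.trans hKN
  have hN' : (0 : ℝ) < N := by exact_mod_cast hN
  have hd2 : 2 * d ≤ N := by
    have : 2 * (d : ℝ) ≤ N := by nlinarith
    exact_mod_cast this
  rcases (accumulateProb_nonneg N (w * q) h).eq_or_lt with e | hp1
  · rw [← e, zero_mul, mul_zero]; positivity
  rcases (accumulateProb_nonneg N h d).eq_or_lt with e | hp2
  · rw [← e, mul_zero, mul_zero]; positivity
  have hp0 : (0 : ℝ) < K.choose w := by exact_mod_cast Nat.choose_pos hw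
  obtain ⟨g1, g2⟩ := le_of_accumulateProb_pos hp1
  obtain ⟨g3, g4⟩ := le_of_accumulateProb_pos hp2
  have hP1 := log_accumulateProb_le_of_half hN (b := w * q / 2) (by omega) (by omega) hwN rfl hp1
  have hP2 := log_accumulateProb_le_accExponent hN hh hd2 hp2
  set b := w * q / 2 with hb
  have hF := hc ((2 * b : ℕ) / N) (h / N) (d / N) (by positivity)
    (by rw [← mul_div_assoc]; gcongr; exact_mod_cast (by omega : 2 * b ≤ 2 * h))
    (by
      rw [one_sub_div hN'.ne', ← mul_div_assoc]
      gcongr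
      have : ((2 * b : ℕ) : ℝ) + 2 * h ≤ 2 * N := by
        exact_mod_cast (by omega : 2 * b + 2 * h ≤ 2 * N)
      linarith)
    (by have : (0 : ℝ) < h := by exact_mod_cast h0
        positivity)
    (by rw [← mul_div_assoc]; gcongr; exact_mod_cast (by omega : h ≤ 2 * d))
    (by rw [div_le_iff₀ hN']; exact hd)
  have hF' : N * extExponent q ((2 * b : ℕ) / N) (h / N) (d / N) ≤ -(c * h) := by
    have := mul_le_mul_of_nonneg_left hF hN'.le
    have e : N * -(c * (h / N)) = -(c * h) := by field_simp
    rwa [e] at this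
  unfold extExponent at hF'
  rw [mul_add, mul_add] at hF'
  rw [← log_le_iff_le_exp (by positivity), log_mul hp0.ne' (by positivity),
    log_mul hp1.ne' hp2.ne']
  linarith

/-- The union bound, cut at the intermediate weight `L`. Below `L` the second stage is bounded by a
probability, above `L` by the exponent. -/
theorem sum_choose_mul_accumulateProb_le {q K : ℕ} (hq : 3 ≤ q) (hK : 1 ≤ K) {r c L : ℝ}
    (hr : r < 1 / 2)
    (hc0 : 0 < c)
    (hc : ∀ α β ρ : ℝ, 0 ≤ α → α ≤ 2 * β → α ≤ 2 * (1 - β) → 0 < β → β ≤ 2 * ρ → ρ ≤ r →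
      extExponent q α β ρ ≤ -(c * β)) (hL : 1 ≤ L) (hLN : 8 * L ^ 3 ≤ √((K * q : ℕ) : ℝ)) :
    ∑ w ∈ Icc 1 K, (K.choose w : ℝ) *
      ∑ h ∈ range (K * q + 1), accumulateProb (K * q) (w * q) h *
        accumulateTail (K * q) h (r * (K * q : ℕ))
      ≤ 16 * L ^ 5 / √((K * q : ℕ) : ℝ)
        + ((K * q : ℕ) + 1) ^ 3 * exp (24 * (1 + log (K * q : ℕ)) - c * L) := by
  set N := K * q with hNdef
  have hKN : K ≤ N := Nat.le_mul_of_pos_right K (by omega)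
  have hKN' : (K : ℝ) ≤ N := by exact_mod_cast hKN
  have hs : 0 < √(N : ℝ) := lt_of_lt_of_le (by positivity) hLN
  set X := exp (24 * (1 + log (N : ℕ)) - c * L) with hX
  -- one term, for `h ≤ L` and for `L < h`
  have hterm : ∀ w ∈ Icc 1 K, ∀ h ∈ range (N + 1),
      (K.choose w : ℝ) * (accumulateProb N (w * q) h * accumulateTail N h (r * N))
        ≤ (if (h : ℝ) ≤ L ∧ (w : ℝ) ≤ L then 8 * L ^ 3 / √(N : ℝ) else 0) + (N + 1) * X := by
    intro w hw h hh
    rw [mem_Icc] at hw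
    rw [mem_range] at hh
    have hXN : 0 ≤ (N + 1) * X := by positivity
    rcases le_or_gt (h : ℝ) L with hle | hgt
    · have hT := accumulateTail_le_one N h (r * N)
      have hP0 := accumulateProb_nonneg N (w * q) h
      rcases lt_or_ge h w with hwh | hwh
      · have hwq : 3 * w ≤ w * q := by nlinarith
        rw [accumulateProb_eq_zero (by omega), zero_mul, mul_zero]
        positivity
      · rw [if_pos ⟨hle, le_trans (by exact_mod_cast hwh) hle⟩]
        have hh3 : (h : ℝ) ^ 3 ≤ L ^ 3 := by gcongr
        have h1 := choose_mul_accumulateProb_le (w := w) hq hw.1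
          (show 8 * (h : ℝ) ^ 3 ≤ √((K * q : ℕ) : ℝ) by linarith)
        have h2 : 8 * (h : ℝ) ^ 3 / √(N : ℝ) ≤ 8 * L ^ 3 / √(N : ℝ) := by gcongr
        have h3 : (K.choose w : ℝ) * (accumulateProb N (w * q) h * accumulateTail N h (r * N))
            ≤ (K.choose w : ℝ) * accumulateProb N (w * q) h := by
          rw [← mul_assoc]
          exact mul_le_of_le_one_right (by positivity) hT
        linarith
    · have h0 : 0 < h := by
        have : (0 : ℝ) < h := by linarith
        exact_mod_cast this
      refine le_add_of_nonneg_of_le (by split_ifs <;> positivity) ?_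
      rw [accumulateTail, mul_sum, mul_sum]
      have hone : ∀ d ∈ (range (N + 1)).filter fun d : ℕ => (d : ℝ) ≤ r * N,
          (K.choose w : ℝ) * (accumulateProb N (w * q) h * accumulateProb N h d) ≤ X := by
        intro d hd
        refine (choose_mul_accumulateProb_mul_le_exp (by omega) hK hw.2 h0 hr hc (by omega)
          (mem_filter.1 hd).2).trans ?_
        rw [hX]
        apply exp_le_exp.2
        have := mul_le_mul_of_nonneg_left hgt.le hc0.le
        linarith
      refine (sum_le_card_nsmul _ _ _ hone).trans ?_
      rw [nsmul_eq_mul]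
      gcongr
      have := card_filter_le (range (N + 1)) fun d : ℕ => (d : ℝ) ≤ r * N
      rw [card_range] at this
      exact_mod_cast this
  have hcount : ∀ s : Finset ℕ, (#(s.filter fun i : ℕ => (i : ℝ) ≤ L) : ℝ) ≤ L + 1 := by
    intro s
    have : (s.filter fun i : ℕ => (i : ℝ) ≤ L) ⊆ range (⌊L⌋₊ + 1) := by
      intro i hi
      rw [mem_range, Nat.lt_succ_iff]
      exact Nat.le_floor (mem_filter.1 hi).2
    have h1 := card_le_card this
    rw [card_range] at h1
    have h2 : (#(s.filter fun i : ℕ => (i : ℝ) ≤ L) : ℝ) ≤ (⌊L⌋₊ : ℝ) + 1 := by exact_mod_cast h1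
    linarith [Nat.floor_le (show 0 ≤ L by linarith)]
  have hcountw : (#((Icc 1 K).filter fun i : ℕ => (i : ℝ) ≤ L) : ℝ) ≤ L := by
    have : ((Icc 1 K).filter fun i : ℕ => (i : ℝ) ≤ L) ⊆ Icc 1 ⌊L⌋₊ := by
      intro i hi
      rw [mem_filter, mem_Icc] at hi
      exact mem_Icc.2 ⟨hi.1.1, Nat.le_floor hi.2⟩
    have h1 := card_le_card this
    rw [Nat.card_Icc, Nat.add_sub_cancel] at h1
    exact (Nat.cast_le.2 h1).trans (Nat.floor_le (by linarith))
  have hsmall : ∑ w ∈ Icc 1 K, ∑ h ∈ range (N + 1),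
      (if (h : ℝ) ≤ L ∧ (w : ℝ) ≤ L then 8 * L ^ 3 / √(N : ℝ) else 0)
      ≤ 16 * L ^ 5 / √(N : ℝ) := by
    have : ∑ w ∈ Icc 1 K, ∑ h ∈ range (N + 1),
        (if (h : ℝ) ≤ L ∧ (w : ℝ) ≤ L then 8 * L ^ 3 / √(N : ℝ) else 0)
        = #((Icc 1 K).filter fun i : ℕ => (i : ℝ) ≤ L) *
          (#((range (N + 1)).filter fun i : ℕ => (i : ℝ) ≤ L) * (8 * L ^ 3 / √(N : ℝ))) := by
      rw [← nsmul_eq_mul, ← nsmul_eq_mul, ← sum_const, ← sum_const, sum_filter]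
      refine sum_congr rfl fun w _ => ?_
      split_ifs with hwL
      · rw [sum_filter]
        simp [hwL]
      · simp [hwL]
    rw [this]
    calc _ ≤ L * ((L + 1) * (8 * L ^ 3 / √(N : ℝ))) := by
          gcongr
          exact hcount _
      _ ≤ L * ((L + L) * (8 * L ^ 3 / √(N : ℝ))) := by gcongr
      _ = _ := by ring
  calc _ = ∑ w ∈ Icc 1 K, ∑ h ∈ range (N + 1),
        (K.choose w : ℝ) * (accumulateProb N (w * q) h * accumulateTail N h (r * N)) := by
        simp only [mul_sum]
    _ ≤ ∑ w ∈ Icc 1 K, ∑ h ∈ range (N + 1),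
        ((if (h : ℝ) ≤ L ∧ (w : ℝ) ≤ L then 8 * L ^ 3 / √(N : ℝ) else 0) + (N + 1) * X) :=
        sum_le_sum fun w hw => sum_le_sum fun h hh => hterm w hw h hh
    _ ≤ 16 * L ^ 5 / √(N : ℝ) + K * ((N + 1) * ((N + 1) * X)) := by
        simp only [sum_add_distrib]
        refine add_le_add hsmall (le_of_eq ?_)
        simp [sum_const]
    _ ≤ 16 * L ^ 5 / √(N : ℝ) + (N + 1) * ((N + 1) * ((N + 1) * X)) := by
        gcongr
        linarith
    _ = _ := by ring

theorem raaFraction_le_one (q K : ℕ) (ρ : ℝ) : raaFraction q K ρ ≤ 1 := by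
  refine div_le_one_of_le₀ ?_ (Nat.cast_nonneg _)
  exact_mod_cast Finite.card_subtype_le _

theorem raaFraction_anti (q K : ℕ) {ρ ρ' : ℝ} (h : ρ ≤ ρ') :
    raaFraction q K ρ' ≤ raaFraction q K ρ := by
  unfold raaFraction
  gcongr
  refine Nat.card_le_card_of_injective
    (Subtype.map id fun _ hσ => lt_of_le_of_lt ?_ hσ)
    (Subtype.map_injective _ Function.injective_id)
  gcongr

theorem tendsto_raaFraction {q : ℕ} (hq : 3 ≤ q) {r c : ℝ} (hr : r < 1 / 2) (hc0 : 0 < c)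
    (hc : ∀ α β ρ : ℝ, 0 ≤ α → α ≤ 2 * β → α ≤ 2 * (1 - β) → 0 < β → β ≤ 2 * ρ → ρ ≤ r →
      extExponent q α β ρ ≤ -(c * β)) :
    Tendsto (fun K : ℕ => raaFraction q K r) atTop (𝓝 1) := by
  -- the cut between small and large intermediate weights is at `L = N ^ (1 / 20)`
  set L : ℕ → ℝ := fun K => ((K * q : ℕ) : ℝ) ^ (1 / 20 : ℝ) with hL
  have hL20 : ∀ K, L K ^ 20 = (K * q : ℕ) := by
    intro K
    rw [hL, ← rpow_natCast, ← rpow_mul (by positivity)]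
    norm_num
  have hLtop : Tendsto L atTop atTop := by
    refine (tendsto_rpow_atTop (by norm_num)).comp (tendsto_natCast_atTop_atTop.comp ?_)
    exact tendsto_id.atTop_mul_const' (by omega)
  -- `540 = 20 * (3 + 24)`, as the polynomial factors of the large weights amount to `N ^ 27`
  set g : ℝ → ℝ := fun t => 16 / t ^ 5 + 8 * exp 24 * (t ^ 540 * exp (-(c * t))) with hg
  have hg0 : Tendsto g atTop (𝓝 0) := by
    have h1 : Tendsto (fun t : ℝ => 16 / t ^ 5) atTop (𝓝 0) :=
      tendsto_const_nhds.div_atTop (tendsto_pow_atTop (by norm_num))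
    have h2 : Tendsto (fun t : ℝ => t ^ 540 * exp (-(c * t))) atTop (𝓝 0) := by
      have := tendsto_rpow_mul_exp_neg_mul_atTop_nhds_zero 540 c hc0
      refine this.congr fun t => ?_
      rw [neg_mul]
      norm_cast
    simpa using h1.add (h2.const_mul (8 * exp 24))
  have hlow : ∀ᶠ K : ℕ in atTop, 1 - g (L K) ≤ raaFraction q K r := by
    filter_upwards [eventually_ge_atTop 1, hLtop.eventually_ge_atTop 2] with K hK hL2
    have hNL := hL20 K
    have hs : √((K * q : ℕ) : ℝ) = L K ^ 10 := by
      rw [← hNL, show L K ^ 20 = (L K ^ 10) ^ 2 by ring, sqrt_sq (by positivity)]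
    have h8 : 8 * L K ^ 3 ≤ √((K * q : ℕ) : ℝ) := by
      rw [hs]
      calc 8 * L K ^ 3 = 2 ^ 3 * L K ^ 3 := by norm_num
        _ ≤ L K ^ 3 * L K ^ 3 := by gcongr
        _ = L K ^ 6 := by ring
        _ ≤ L K ^ 10 := pow_le_pow_right₀ (by linarith) (by norm_num)
    have h1 := one_sub_raaFraction_le (q := q) (by omega) hK r
    have h2 := sum_choose_mul_accumulateProb_le hq hK hr hc0 hc (by linarith : 1 ≤ L K) h8
    have hN1 : (1 : ℝ) ≤ (K * q : ℕ) := by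
      exact_mod_cast Nat.one_le_iff_ne_zero.2 (by positivity)
    have h3 : (((K * q : ℕ) : ℝ) + 1) ^ 3 * exp (24 * (1 + log (K * q : ℕ)) - c * L K)
        ≤ 8 * exp 24 * (L K ^ 540 * exp (-(c * L K))) := by
      have e1 : exp (24 * (1 + log (K * q : ℕ)) - c * L K)
          = exp 24 * ((K * q : ℕ) : ℝ) ^ 24 * exp (-(c * L K)) := by
        rw [show 24 * (1 + log (K * q : ℕ)) - c * L K
          = 24 + (24 : ℕ) * log (K * q : ℕ) + -(c * L K) by push_cast; ring, exp_add, exp_add,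
          exp_nat_mul, exp_log (by linarith)]
      rw [e1]
      calc _ ≤ (((K * q : ℕ) : ℝ) + (K * q : ℕ)) ^ 3 *
            (exp 24 * ((K * q : ℕ) : ℝ) ^ 24 * exp (-(c * L K))) := by gcongr
        _ = 8 * exp 24 * (((K * q : ℕ) : ℝ) ^ 27 * exp (-(c * L K))) := by ring
        _ = _ := by rw [← hNL, ← pow_mul]
    have h4 : 16 * L K ^ 5 / √((K * q : ℕ) : ℝ) = 16 / L K ^ 5 := by
      rw [hs]
      field_simp
    rw [hg]
    simp only
    linarith
  refine tendsto_of_tendsto_of_tendsto_of_le_of_le' ?_ tendsto_const_nhds hlow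
    (Eventually.of_forall fun K => raaFraction_le_one q K r)
  simpa using (hg0.comp hLtop).const_sub 1

end

/-! ### The threshold and the ensemble -/

theorem theorem2 (q : ℕ) (hq : 3 ≤ q) :
    -- the solutions of the system are the stationary points of the exponent inside the region
    (∀ ρ : ℝ, 0 < ρ → ρ ≤ 1 / 2 → ∀ α β : ℝ,
      RaaSystem q α β ρ ↔
        ((α, β) ∈ interior (raaRegion ρ) ∧
          HasDerivAt (fun a => raaExponent q a β ρ) 0 α ∧
          HasDerivAt (fun b => raaExponent q α b ρ) 0 β)) ∧
    -- a maximum of the exponent over the region is located at a solution of the system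
    (∀ ρ : ℝ, 0 < ρ → ρ ≤ 1 / 2 → ∀ p ∈ raaRegion ρ,
      IsMaxOn (fun p : ℝ × ℝ => raaExponent q p.1 p.2 ρ) (raaRegion ρ) p →
        RaaSystem q p.1 p.2 ρ) ∧
    -- a nonnegative maximum over the region is the maximum over the solutions, and conversely
    (∀ ρ : ℝ, 0 < ρ → ρ ≤ 1 / 2 → ∀ m : ℝ, 0 ≤ m →
      (IsGreatest (raaValues q ρ) m ↔ IsGreatest (raaSystemValues q ρ) m)) ∧
    ∃ ρhat : ℝ, 0 < ρhat ∧ ρhat < 1 / 2 ∧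
      -- `ρhat` is the zero crossing of the maximum of the exponent
      (∀ ρ : ℝ, 0 < ρ → ρ < ρhat → ∀ y ∈ raaValues q ρ, y < 0) ∧
      IsGreatest (raaValues q ρhat) 0 ∧
      (∀ ρ : ℝ, ρhat < ρ → ρ ≤ 1 / 2 → ∃ m : ℝ, 0 < m ∧ IsGreatest (raaValues q ρ) m) ∧
      -- `ρhat` in terms of the solutions of the system
      IsLeast {ρ : ℝ | (0 : ℝ) ∈ raaSystemValues q ρ} ρhat ∧
      -- almost all codes have minimum distance greater than `ρ * N`, for every `ρ < ρhat`
      (∀ ρ : ℝ, ρ < ρhat →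
        Filter.Tendsto (fun K : ℕ => raaFraction q K ρ) Filter.atTop (nhds 1)) := by
  have hq0 : 0 < q := by omega
  obtain ⟨ρhat, h0, h1, hbelow, hzero⟩ := exists_threshold hq
  have hgreat : IsGreatest (raaValues q ρhat) 0 := hzero
  refine ⟨fun ρ _ hρ α β => raaSystem_iff_stationary hq0 hρ,
    fun ρ _ hρ p hp hmax => raaSystem_of_isMaxOn hq0 hρ hp hmax,
    fun ρ hρ0 hρ m hm => isGreatest_raaValues_iff hq0 hρ0 hρ hm,
    ρhat, h0, h1, hbelow, hgreat, ?_, ⟨?_, ?_⟩, ?_⟩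
  · intro ρ hlt hρ
    obtain ⟨⟨α, β⟩, hmem, he⟩ := hgreat.1
    have hpos := raaExponent_lt_of_lt (q := q) hmem hlt hρ
    simp only at he
    rw [he] at hpos
    obtain ⟨m, hm, hG⟩ := exists_isGreatest_raaValues (h0.trans hlt) hρ
      ⟨_, raaRegion_mono hlt.le hρ hmem, rfl⟩ hpos
    exact ⟨m, hpos.trans_le hm, hG⟩
  · exact (isGreatest_raaSystemValues hq0 h1.le hgreat).1
  · rintro ρ ⟨α, β, hsys, he⟩
    by_contra! hlt
    have hρ : ρ ≤ 1 / 2 := by linarith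
    have hmem := interior_subset ((raaSystem_iff_stationary hq0 hρ).1 hsys).1
    obtain ⟨g0, g1, g2, g3⟩ := (mem_raaRegion hρ).1 hmem
    have := hbelow ρ (by linarith) hlt _ ⟨_, hmem, rfl⟩
    simp only at this
    linarith
  · intro ρ hρ
    -- the fraction decreases in `ρ`, so that `ρ` may be replaced by a positive number
    obtain ⟨r, hr1, hr2⟩ := exists_between (max_lt hρ h0)
    have hr0 : 0 < r := (le_max_right _ _).trans_lt hr1
    obtain ⟨c, hc0, hc⟩ := exists_extExponent_le_neg_of_lt_threshold hq hr0 (hr2.trans h1)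
      fun t ht htr => hbelow t ht (htr.trans_lt hr2)
    exact tendsto_of_tendsto_of_tendsto_of_le_of_le
      (tendsto_raaFraction hq (hr2.trans h1) hc0 hc) tendsto_const_nhds
      (fun K => raaFraction_anti q K ((le_max_left _ _).trans hr1.le))
      (fun K => raaFraction_le_one q K ρ)
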